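/- Conventions. Objects of a category are identified with their identity arrows, and composition is written in diagrammatic order. An \emph{inductive groupoid} is a groupoid with a partial order $\le$ on its arrows such that (i) $x\le y$ implies $x^{-1}\le y^{-1}$; (ii) $x\le y$ and $u\le v$ imply $xu\le yv$ whenever both composites exist; (iii) for every object $e\le x\,\mathrm{dom}$ there is a unique arrow $(e\,{}_*|\,x)\le x$ with domain $e$ (restriction), and for every object $e\le x\,\mathrm{cod}$ a unique arrow $(x\,|_*\,e)\le x$ with codomain $e$ (corestriction); (iv) the objects form a meet-semilattice. A \emph{double inductive groupoid} $\mathcal G$ is a double groupoid with objects $\mathrm{Obj}$, vertical arrows $\mathrm{Ver}$, horizontal arrows $\mathrm{Hor}$ and double cells $\mathrm{Dbl}$ (vertical arrows, horizontal arrows and objects being identified with the horizontal, the vertical and the two-sided identity cells, so that $\mathrm{Obj}=\mathrm{Ver}\cap\mathrm{Hor}$), and partial orders $\le$ and $\lesssim$ on $\mathrm{Dbl}$, such that $(\mathrm{Ver},\mathrm{Dbl})$ with horizontal composition $\circ$, order $\le$, meet $\wedge_h$ and (co)restrictions $(\;{}_*|\;)$, $(\;|_*\;)$, and $(\mathrm{Hor},\mathrm{Dbl})$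 with vertical composition $\bullet$, order $\lesssim$, meet $\wedge_v$ and (co)restrictions $[\;{}_*|\;]$, $[\;|_*\;]$, are inductive groupoids, and the following hold whenever both sides are defined, together with the laws obtained by exchanging the horizontal and the vertical direction and by replacing corestrictions and codomains by restrictions and domains (in either direction independently): (a) $(a\bullet b\,|_*\,f\bullet g)=(a\,|_*\,f)\bullet(b\,|_*\,g)$; (b) $(e\wedge_h f)\bullet(g\wedge_h h)=(e\bullet g)\wedge_h(f\bullet h)$; (c) $(e\,|_*\,f)\wedge_v(g\,|_*\,h)=(e\wedge_v g\,|_*\,f\wedge_v h)$ for horizontal arrows $e,g$ and objects $f,h$; (d) $([a\,|_*\,f]\,|_*\,[g\,|_*\,x])=[(a\,|_*\,g)\,|_*\,(f\,|_*\,x)]$ for a double cell $a$, a horizontal arrow $f\lesssim a\,\mathrm{vcod}$, a vertical arrow $g\le a\,\mathrm{hcod}$ and an object $x$ with $x\le f\,\mathrm{hcod}$ and $x\lesssim g\,\mathrm{vcod}$; (e) $(e\wedge_h f)\wedge_v(g\wedge_h h)=(e\wedge_v g)\wedge_h(f\wedge_v h)$ for objects $e,f,g,h$; (f) $(e\wedge_h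 f)\,\mathrm{vcod}=e\,\mathrm{vcod}\wedge_h f\,\mathrm{vcod}$ for vertical arrows $e,f$; (g) $(a\,|_*\,e)\,\mathrm{vcod}=(a\,\mathrm{vcod}\,|_*\,e\,\mathrm{vcod})$ for a double cell $a$ and a vertical arrow $e\le a\,\mathrm{hcod}$. A \emph{double inductive functor} is a double functor whose vertical arrow, horizontal arrow and double cell functions preserve all the partial orders and meets. These form the category $\mathbf{DIG}$. A \emph{double inverse semigroup} $(S,\circledcirc,\odot)$ is a set with two inverse semigroup operations (associative, and each element $a$ has a unique $a'$ with $aa'a=a$ and $a'aa'=a'$) such that $(a\odot b)\circledcirc(c\odot d)=(a\circledcirc c)\odot(b\circledcirc d)$ for all $a,b,c,d$. With the maps preserving both operations they form the category $\mathbf{DIS}$. Write $E(S,\cdot)$ for the set of idempotents, and $a^{\circledcirc}$, $a^{\odot}$ for the inverses. \textbf{Theorem.} (1) For a double inductive groupoid $\mathcal G$, the set $\mathrm{Dbl}(\mathcal G)$ with $$a\circledcirc b=(a\,|_*\,m)\circ(m\,{}_*|\,b),\quad m=a\,\mathrm{hcod}\wedge_h b\,\mathrm{hdom},\qquad a\odot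 b=[a\,|_*\,n]\bullet[n\,{}_*|\,b],\quad n=a\,\mathrm{vcod}\wedge_v b\,\mathrm{vdom},$$ is a double inverse semigroup $\mathit{DIS}(\mathcal G)$; the double cell function of a double inductive functor $\mathcal G\to\mathcal G'$ is a double semigroup homomorphism $\mathit{DIS}(\mathcal G)\to\mathit{DIS}(\mathcal G')$; and this defines a functor $F:\mathbf{DIG}\to\mathbf{DIS}$. (2) For a double inverse semigroup $S$ there is a double inductive groupoid $\mathit{DIG}(S)$ with double cells $S$, vertical arrows $E(S,\circledcirc)$, horizontal arrows $E(S,\odot)$ and objects $E(S,\circledcirc)\cap E(S,\odot)$; with $a\,\mathrm{hdom}=a\circledcirc a^{\circledcirc}$, $a\,\mathrm{hcod}=a^{\circledcirc}\circledcirc a$, horizontal inverse $a^{\circledcirc}$, horizontal composites, meets, restrictions and corestrictions all given by $\circledcirc$, and $a\le b$ if and only if $a=e\circledcirc b$ for some $e\in E(S,\circledcirc)$; and with the vertical structure given in the same way by $\odot$. Each double semigroup homomorphism $\varphi:S\to S'$ is the double cell function of a double inductive functor $\mathit{DIG}(S)\to\mathit{DIG}(S')$ whose object and arrow functions are restrictions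 of $\varphi$; and this defines a functor $F':\mathbf{DIS}\to\mathbf{DIG}$. (3) $F$ and $F'$ form an isomorphism of categories: $FF'=\mathrm{id}_{\mathbf{DIG}}$ and $F'F=\mathrm{id}_{\mathbf{DIS}}$. -/

import Mathlib

open CategoryTheory

universe u

/-! Categories are treated in their arrows-only form: every object is identified with its identity
arrow. Thus the data below live on the set of arrows, and the objects form a subset of it. -/

/-- The operations and relations of an inductive groupoid with set of arrows `D`, without any laws.
Composition is written in diagrammatic order and, like meets, restrictions and corestrictions,
it is only defined on the arguments where it makes sense. -/
@[ext]
structure InductiveGroupoidData (D : Type u) where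
  /-- The objects (identity arrows). -/
  obj : Set D
  /-- The domain, as an identity arrow. -/
  dom : D → D
  /-- The codomain, as an identity arrow. -/
  cod : D → D
  /-- The composite `a ; b`. -/
  comp : ∀ a b : D, cod a = dom b → D
  /-- The inverse of an arrow. -/
  inv : D → D
  /-- The order on the arrows. -/
  le : D → D → Prop
  /-- The meet of two objects. -/
  meet : ∀ e f : D, e ∈ obj → f ∈ obj → D
  /-- The restriction `(e _*| a)` of `a` by an object `e ≤ dom a`. -/
  res : ∀ e a : D, e ∈ obj → le e (dom a) → D
  /-- The corestriction `(a |_* e)` of `a` by an object `e ≤ cod a`. -/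
  cores : ∀ a e : D, e ∈ obj → le e (cod a) → D

/-- The laws of an inductive groupoid: a groupoid with a partial order on its arrows that is
preserved by inverses and composition, with unique restrictions and corestrictions, and whose
objects form a meet-semilattice. -/
structure IsInductiveGroupoid {D : Type u} (G : InductiveGroupoidData D) : Prop where
  -- groupoid
  dom_mem : ∀ a, G.dom a ∈ G.obj
  cod_mem : ∀ a, G.cod a ∈ G.obj
  dom_obj : ∀ e ∈ G.obj, G.dom e = e
  cod_obj : ∀ e ∈ G.obj, G.cod e = e
  dom_comp : ∀ a b h, G.dom (G.comp a b h) = G.dom a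
  cod_comp : ∀ a b h, G.cod (G.comp a b h) = G.cod b
  id_comp : ∀ a h, G.comp (G.dom a) a h = a
  comp_id : ∀ a h, G.comp a (G.cod a) h = a
  assoc : ∀ a b c hab hbc hab_c ha_bc,
    G.comp (G.comp a b hab) c hab_c = G.comp a (G.comp b c hbc) ha_bc
  dom_inv : ∀ a, G.dom (G.inv a) = G.cod a
  cod_inv : ∀ a, G.cod (G.inv a) = G.dom a
  comp_inv : ∀ a h, G.comp a (G.inv a) h = G.dom a
  inv_comp : ∀ a h, G.comp (G.inv a) a h = G.cod a
  -- partial order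
  le_refl : ∀ a, G.le a a
  le_trans : ∀ a b c, G.le a b → G.le b c → G.le a c
  le_antisymm : ∀ a b, G.le a b → G.le b a → a = b
  -- ordered groupoid
  inv_le_inv : ∀ x y, G.le x y → G.le (G.inv x) (G.inv y)
  comp_le_comp : ∀ x y u v hxu hyv, G.le x y → G.le u v → G.le (G.comp x u hxu) (G.comp y v hyv)
  res_le : ∀ e x he h, G.le (G.res e x he h) x
  dom_res : ∀ e x he h, G.dom (G.res e x he h) = e
  res_unique : ∀ e x he h y, G.le y x → G.dom y = e → y = G.res e x he h
  cores_le : ∀ x e he h, G.le (G.cores x e he h) x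
  cod_cores : ∀ x e he h, G.cod (G.cores x e he h) = e
  cores_unique : ∀ x e he h y, G.le y x → G.cod y = e → y = G.cores x e he h
  -- the objects form a meet-semilattice
  meet_mem : ∀ e f he hf, G.meet e f he hf ∈ G.obj
  meet_le_left : ∀ e f he hf, G.le (G.meet e f he hf) e
  meet_le_right : ∀ e f he hf, G.le (G.meet e f he hf) f
  le_meet : ∀ e f he hf, ∀ g ∈ G.obj, G.le g e → G.le g f → G.le g (G.meet e f he hf)

/-- The product `(a |_* m) ; (m _*| b)`, where `m` is the meet of the codomain of `a` and the domain
of `b`, on the arrows of an inductive groupoid. -/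
def InductiveGroupoidData.prod {D : Type u} (G : InductiveGroupoidData D)
    (hG : IsInductiveGroupoid G) (a b : D) : D :=
  let m := G.meet (G.cod a) (G.dom b) (hG.cod_mem a) (hG.dom_mem b)
  have hm : m ∈ G.obj := hG.meet_mem _ _ _ _
  have ha : G.le m (G.cod a) := hG.meet_le_left _ _ _ _
  have hb : G.le m (G.dom b) := hG.meet_le_right _ _ _ _
  G.comp (G.cores a m hm ha) (G.res m b hm hb)
    ((hG.cod_cores a m hm ha).trans (hG.dom_res m b hm hb).symm)

/-- A function between the sets of arrows is an inductive functor: it is a functor which preserves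
the order and the meets of objects. -/
structure IsInductiveFunctor {D D' : Type u} (G : InductiveGroupoidData D)
    (G' : InductiveGroupoidData D') (f : D → D') : Prop where
  map_obj : ∀ e ∈ G.obj, f e ∈ G'.obj
  map_dom : ∀ a, f (G.dom a) = G'.dom (f a)
  map_cod : ∀ a, f (G.cod a) = G'.cod (f a)
  map_comp : ∀ a b h h', f (G.comp a b h) = G'.comp (f a) (f b) h'
  map_le : ∀ a b, G.le a b → G'.le (f a) (f b)
  map_meet : ∀ d e hd he hd' he', f (G.meet d e hd he) = G'.meet (f d) (f e) hd' he'

/-- The half of the compatibility laws between two inductive groupoid structures `A` and `B` on the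
same set of double cells that concerns domains, codomains and compositions of `B`, and meets,
restrictions and corestrictions of `A`; a double inductive groupoid satisfies them also with the two
structures interchanged. Objects of `A` are arrows in the direction of `B`, and conversely. Every
law is required whenever all the expressions in it are defined. -/
structure IsHalfCompatible {D : Type u} (A B : InductiveGroupoidData D) : Prop where
  -- domains and codomains of `B` are functorial for the composition of `A`
  dom_comp : ∀ a b h h', B.dom (A.comp a b h) = A.comp (B.dom a) (B.dom b) h'
  cod_comp : ∀ a b h h', B.cod (A.comp a b h) = A.comp (B.cod a) (B.cod b) h'
  -- composition and (co)restriction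
  cores_comp : ∀ a b f g (hab : B.cod a = B.dom b) (hfg : B.cod f = B.dom g)
    hfgm hfgl hf hfl hg hgl h,
    A.cores (B.comp a b hab) (B.comp f g hfg) hfgm hfgl =
      B.comp (A.cores a f hf hfl) (A.cores b g hg hgl) h
  res_comp : ∀ a b f g (hab : B.cod a = B.dom b) (hfg : B.cod f = B.dom g)
    hfgm hfgl hf hfl hg hgl h,
    A.res (B.comp f g hfg) (B.comp a b hab) hfgm hfgl =
      B.comp (A.res f a hf hfl) (A.res g b hg hgl) h
  -- composition and meet
  meet_comp : ∀ e f g h (he : e ∈ A.obj) (hf : f ∈ A.obj) (hg : g ∈ A.obj) (hh : h ∈ A.obj)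
    (heg : B.cod e = B.dom g) (hfh : B.cod f = B.dom h) hc hegm hfhm,
    B.comp (A.meet e f he hf) (A.meet g h hg hh) hc =
      A.meet (B.comp e g heg) (B.comp f h hfh) hegm hfhm
  -- meet and (co)restriction
  meet_cores : ∀ e f g h (he : e ∈ B.obj) (hg : g ∈ B.obj) (hf : f ∈ A.obj) (hf' : f ∈ B.obj)
    (hh : h ∈ A.obj) (hh' : h ∈ B.obj) (hfe : A.le f (A.cod e)) (hhg : A.le h (A.cod g))
    h₁ h₂ h₃ h₄,
    B.meet (A.cores e f hf hfe) (A.cores g h hh hhg) h₁ h₂ =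
      A.cores (B.meet e g he hg) (B.meet f h hf' hh') h₃ h₄
  meet_res : ∀ e f g h (he : e ∈ B.obj) (hg : g ∈ B.obj) (hf : f ∈ A.obj) (hf' : f ∈ B.obj)
    (hh : h ∈ A.obj) (hh' : h ∈ B.obj) (hfe : A.le f (A.dom e)) (hhg : A.le h (A.dom g))
    h₁ h₂ h₃ h₄,
    B.meet (A.res f e hf hfe) (A.res h g hh hhg) h₁ h₂ =
      A.res (B.meet f h hf' hh') (B.meet e g he hg) h₃ h₄
  -- (co)domain and meet
  dom_meet : ∀ e f he hf he' hf', B.dom (A.meet e f he hf) = A.meet (B.dom e) (B.dom f) he' hf'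
  cod_meet : ∀ e f he hf he' hf', B.cod (A.meet e f he hf) = A.meet (B.cod e) (B.cod f) he' hf'
  -- (co)domain and (co)restriction
  dom_cores : ∀ a e he h he' h', B.dom (A.cores a e he h) = A.cores (B.dom a) (B.dom e) he' h'
  cod_cores : ∀ a e he h he' h', B.cod (A.cores a e he h) = A.cores (B.cod a) (B.cod e) he' h'
  dom_res : ∀ a e he h he' h', B.dom (A.res e a he h) = A.res (B.dom e) (B.dom a) he' h'
  cod_res : ∀ a e he h he' h', B.cod (A.res e a he h) = A.res (B.cod e) (B.cod a) he' h'

/-- The laws of a double inductive groupoid with set of double cells `D`. The horizontal structure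
is `H` and the vertical one is `V`. The vertical arrows are the horizontal identity cells, `H.obj`;
the horizontal arrows are the vertical identity cells, `V.obj`; the objects are the cells in both. -/
structure IsDoubleInductiveGroupoid {D : Type u} (H V : InductiveGroupoidData D) : Prop where
  horiz : IsInductiveGroupoid H
  vert : IsInductiveGroupoid V
  -- double groupoid
  dom_dom : ∀ a, V.dom (H.dom a) = H.dom (V.dom a)
  dom_cod : ∀ a, V.dom (H.cod a) = H.cod (V.dom a)
  cod_dom : ∀ a, V.cod (H.dom a) = H.dom (V.cod a)
  cod_cod : ∀ a, V.cod (H.cod a) = H.cod (V.cod a)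
  interchange : ∀ a b c d hab hcd hac hbd h h',
    V.comp (H.comp a b hab) (H.comp c d hcd) h = H.comp (V.comp a c hac) (V.comp b d hbd) h'
  -- compatibility laws, in both directions
  horiz_vert : IsHalfCompatible H V
  vert_horiz : IsHalfCompatible V H
  -- vertical (co)restriction and horizontal (co)restriction
  cores_cores : ∀ a f g x (hf : f ∈ V.obj) (hfa : V.le f (V.cod a)) (hg : g ∈ H.obj)
    (hga : H.le g (H.cod a)) (hx : x ∈ H.obj) (hx' : x ∈ V.obj)
    (hxf : H.le x (H.cod f)) (hxg : V.le x (V.cod g)) h₁ h₂ h₃ h₄,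
    H.cores (V.cores a f hf hfa) (V.cores g x hx' hxg) h₁ h₂ =
      V.cores (H.cores a g hg hga) (H.cores f x hx hxf) h₃ h₄
  res_res : ∀ a f g x (hf : f ∈ V.obj) (hfa : V.le f (V.dom a)) (hg : g ∈ H.obj)
    (hga : H.le g (H.dom a)) (hx : x ∈ H.obj) (hx' : x ∈ V.obj)
    (hxf : H.le x (H.dom f)) (hxg : V.le x (V.dom g)) h₁ h₂ h₃ h₄,
    H.res (V.res x g hx' hxg) (V.res f a hf hfa) h₁ h₂ =
      V.res (H.res x f hx hxf) (H.res g a hg hga) h₃ h₄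
  res_cores : ∀ a f g x (hf : f ∈ V.obj) (hfa : V.le f (V.cod a)) (hg : g ∈ H.obj)
    (hga : H.le g (H.dom a)) (hx : x ∈ H.obj) (hx' : x ∈ V.obj)
    (hxf : H.le x (H.dom f)) (hxg : V.le x (V.cod g)) h₁ h₂ h₃ h₄,
    H.res (V.cores g x hx' hxg) (V.cores a f hf hfa) h₁ h₂ =
      V.cores (H.res g a hg hga) (H.res x f hx hxf) h₃ h₄
  cores_res : ∀ a f g x (hf : f ∈ V.obj) (hfa : V.le f (V.dom a)) (hg : g ∈ H.obj)
    (hga : H.le g (H.cod a)) (hx : x ∈ H.obj) (hx' : x ∈ V.obj)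
    (hxf : H.le x (H.cod f)) (hxg : V.le x (V.dom g)) h₁ h₂ h₃ h₄,
    H.cores (V.res f a hf hfa) (V.res x g hx' hxg) h₁ h₂ =
      V.res (H.cores f x hx hxf) (H.cores a g hg hga) h₃ h₄
  -- vertical meet and horizontal meet, for objects
  meet_meet : ∀ e f g h (he : e ∈ H.obj) (hf : f ∈ H.obj) (hg : g ∈ H.obj) (hh : h ∈ H.obj)
    (he' : e ∈ V.obj) (hf' : f ∈ V.obj) (hg' : g ∈ V.obj) (hh' : h ∈ V.obj) h₁ h₂ h₃ h₄,
    V.meet (H.meet e f he hf) (H.meet g h hg hh) h₁ h₂ =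
      H.meet (V.meet e g he' hg') (V.meet f h hf' hh') h₃ h₄

/-- A double inductive groupoid. -/
structure DIG : Type (u + 1) where
  /-- The double cells. -/
  Dbl : Type u
  /-- The horizontal inductive groupoid, with the vertical arrows as objects. -/
  H : InductiveGroupoidData Dbl
  /-- The vertical inductive groupoid, with the horizontal arrows as objects. -/
  V : InductiveGroupoidData Dbl
  laws : IsDoubleInductiveGroupoid H V

/-- The vertical arrows of a double inductive groupoid. -/
def DIG.Ver (G : DIG.{u}) : Set G.Dbl := G.H.obj

/-- The horizontal arrows of a double inductive groupoid. -/
def DIG.Hor (G : DIG.{u}) : Set G.Dbl := G.V.obj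

/-- The objects of a double inductive groupoid. -/
def DIG.Obj (G : DIG.{u}) : Set G.Dbl := G.Ver ∩ G.Hor

/-- A double inductive functor. Its vertical arrow, horizontal arrow and object functions are the
restrictions of its double cell function to the vertical arrows, horizontal arrows and objects. -/
@[ext]
structure DoubleInductiveFunctor (G G' : DIG.{u}) where
  /-- The double cell function. -/
  cell : G.Dbl → G'.Dbl
  horiz : IsInductiveFunctor G.H G'.H cell
  vert : IsInductiveFunctor G.V G'.V cell

lemma IsInductiveFunctor.id {D : Type u} (G : InductiveGroupoidData D) :
    IsInductiveFunctor G G (fun x => x) :=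
  ⟨fun _ h => h, fun _ => rfl, fun _ => rfl, fun _ _ _ _ => rfl, fun _ _ h => h,
    fun _ _ _ _ _ _ => rfl⟩

lemma IsInductiveFunctor.comp {D D' D'' : Type u} {G : InductiveGroupoidData D}
    {G' : InductiveGroupoidData D'} {G'' : InductiveGroupoidData D''} {f : D → D'} {g : D' → D''}
    (hf : IsInductiveFunctor G G' f) (hg : IsInductiveFunctor G' G'' g) :
    IsInductiveFunctor G G'' (fun x => g (f x)) where
  map_obj e he := hg.map_obj _ (hf.map_obj e he)
  map_dom a := by rw [hf.map_dom, hg.map_dom]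
  map_cod a := by rw [hf.map_cod, hg.map_cod]
  map_comp a b h h' := by
    have h₁ : G'.cod (f a) = G'.dom (f b) := by rw [← hf.map_cod, ← hf.map_dom, h]
    rw [hf.map_comp a b h h₁, hg.map_comp _ _ h₁ h']
  map_le a b h := hg.map_le _ _ (hf.map_le a b h)
  map_meet d e hd he hd' he' := by
    rw [hf.map_meet d e hd he (hf.map_obj d hd) (hf.map_obj e he), hg.map_meet _ _ _ _ hd' he']

/-- The category of double inductive groupoids and double inductive functors. -/
instance : Category DIG.{u} where
  Hom := DoubleInductiveFunctor
  id G := ⟨fun x => x, IsInductiveFunctor.id G.H, IsInductiveFunctor.id G.V⟩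
  comp f g := ⟨fun x => g.cell (f.cell x), f.horiz.comp g.horiz, f.vert.comp g.vert⟩

/-- An associative operation for which every element has a unique semigroup inverse. -/
structure IsInverseSemigroup {S : Type u} (op : S → S → S) : Prop where
  assoc : ∀ a b c, op (op a b) c = op a (op b c)
  existsUnique_inv : ∀ a, ∃! b, op (op a b) a = a ∧ op (op b a) b = b

/-- The semigroup inverse of an element. -/
noncomputable def IsInverseSemigroup.inv {S : Type u} {op : S → S → S}
    (h : IsInverseSemigroup op) (a : S) : S :=
  (h.existsUnique_inv a).choose

/-- The idempotents of an operation. -/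
def idempotents {S : Type u} (op : S → S → S) : Set S := {e | op e e = e}

/-- Two inverse semigroup operations which satisfy the middle-four interchange law. -/
structure IsDoubleInverseSemigroup {S : Type u} (hop vop : S → S → S) : Prop where
  horiz : IsInverseSemigroup hop
  vert : IsInverseSemigroup vop
  interchange : ∀ a b c d, hop (vop a b) (vop c d) = vop (hop a c) (hop b d)

/-- A double inverse semigroup. -/
structure DIS : Type (u + 1) where
  /-- The underlying set. -/
  carrier : Type u
  /-- The horizontal operation. -/
  hop : carrier → carrier → carrier
  /-- The vertical operation. -/
  vop : carrier → carrier → carrier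
  laws : IsDoubleInverseSemigroup hop vop

/-- A double semigroup homomorphism. -/
@[ext]
structure DoubleSemigroupHom (S S' : DIS.{u}) where
  /-- The underlying function. -/
  toFun : S.carrier → S'.carrier
  map_hop : ∀ a b, toFun (S.hop a b) = S'.hop (toFun a) (toFun b)
  map_vop : ∀ a b, toFun (S.vop a b) = S'.vop (toFun a) (toFun b)

/-- The category of double inverse semigroups and double semigroup homomorphisms. -/
instance : Category DIS.{u} where
  Hom := DoubleSemigroupHom
  id S := ⟨fun x => x, fun _ _ => rfl, fun _ _ => rfl⟩
  comp f g := ⟨fun x => g.toFun (f.toFun x), fun a b => by rw [f.map_hop, g.map_hop],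
    fun a b => by rw [f.map_vop, g.map_vop]⟩

/-- The horizontal product on the double cells of a double inductive groupoid. -/
def DIG.hprod (G : DIG.{u}) : G.Dbl → G.Dbl → G.Dbl := G.H.prod G.laws.horiz

/-- The vertical product on the double cells of a double inductive groupoid. -/
def DIG.vprod (G : DIG.{u}) : G.Dbl → G.Dbl → G.Dbl := G.V.prod G.laws.vert

/-- The data of the inductive groupoid of an inverse semigroup: the objects are the idempotents, the
arrows are all the elements, the order is the natural partial order, and composites, meets,
restrictions and corestrictions are products. -/
noncomputable def IsInverseSemigroup.groupoidData {S : Type u} {op : S → S → S}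
    (h : IsInverseSemigroup op) : InductiveGroupoidData S where
  obj := idempotents op
  dom a := op a (h.inv a)
  cod a := op (h.inv a) a
  comp a b _ := op a b
  inv := h.inv
  le a b := ∃ e ∈ idempotents op, a = op e b
  meet e f _ _ := op e f
  res e a _ _ := op e a
  cores a e _ _ := op a e

/-- The horizontal data of `DIG(S)`. -/
noncomputable def DIS.horizData (S : DIS.{u}) : InductiveGroupoidData S.carrier :=
  S.laws.horiz.groupoidData

/-- The vertical data of `DIG(S)`. -/
noncomputable def DIS.vertData (S : DIS.{u}) : InductiveGroupoidData S.carrier :=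
  S.laws.vert.groupoidData

/-- The functor sending `G` to `DIS(G)`, the double cells of `G` with the horizontal and the vertical
product, and a double inductive functor to its double cell function. The arguments say that this
makes sense. -/
def functorDIS
    (hobj : ∀ G : DIG.{u}, IsDoubleInverseSemigroup G.hprod G.vprod)
    (hmap : ∀ (G G' : DIG.{u}) (f : DoubleInductiveFunctor G G') (a b : G.Dbl),
      f.cell (G.hprod a b) = G'.hprod (f.cell a) (f.cell b) ∧
        f.cell (G.vprod a b) = G'.vprod (f.cell a) (f.cell b)) :
    DIG.{u} ⥤ DIS.{u} where
  obj G := ⟨G.Dbl, G.hprod, G.vprod, hobj G⟩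
  map {G G'} f := ⟨f.cell, fun a b => (hmap G G' f a b).1, fun a b => (hmap G G' f a b).2⟩

/-- The functor sending `S` to `DIG(S)` and a double semigroup homomorphism to the double inductive
functor of which it is the double cell function. The arguments say that this makes sense. -/
noncomputable def functorDIG
    (hobj : ∀ S : DIS.{u}, IsDoubleInductiveGroupoid S.horizData S.vertData)
    (hmap : ∀ (S S' : DIS.{u}) (φ : DoubleSemigroupHom S S'),
      IsInductiveFunctor S.horizData S'.horizData φ.toFun ∧
        IsInductiveFunctor S.vertData S'.vertData φ.toFun) :
    DIS.{u} ⥤ DIG.{u} where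
  obj S := ⟨S.carrier, S.horizData, S.vertData, hobj S⟩
  map {S S'} φ := ⟨φ.toFun, (hmap S S' φ).1, (hmap S S' φ).2⟩

/-!
Every inductive groupoid is an inverse semigroup and can be recovered from it (the
Ehresmann–Schein–Nambooripad correspondence). The product `a ⊗ b` is the largest composite `x ; y`
of arrows `x ≤ a` and `y ≤ b` (`IsInductiveGroupoid.comp_le_prod`), and every arrow below `a ⊗ b` is
such a composite, which makes associativity evident. The idempotents are the objects, on which the
product is the meet.

For a double inductive groupoid, the point is the middle-four interchange law. Horizontal domains
and codomains are inductive functors for the vertical structure, and horizontal composition, meet,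
restriction and corestriction are partial binary operations with the same property
(`IsInductiveOperation`); this is what the compatibility laws say. Such maps preserve the vertical
product, and the horizontal product is composed of them
(`IsDoubleInductiveGroupoid.isDoubleInverseSemigroup`).

For a double inverse semigroup, a form of the Eckmann–Hilton argument, due to Kock, shows that both
operations agree and are commutative. The main step is that a horizontal idempotent is vertically
idempotent (`IsDoubleInverseSemigroup.idempotent_vert_of_horiz`), whence each element has one and
the same domain and range idempotent in both directions, which can play the role of the unit. All
laws of a double inductive groupoid then follow from `(a b) (c d) = (a c) (b d)` in one commutative
inverse semigroup.

Both constructions keep the set of double cells and the underlying functions, so that they are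
inverse to each other as soon as the operations are recovered
(`IsInductiveGroupoid.groupoidData_prod` and `IsInverseSemigroup.prod_groupoidData`).
-/

/-! ### Inverse semigroups -/

namespace IsInverseSemigroup

section

variable {S : Type u} {op : S → S → S}

local infixl:70 " ⊚ " => op

lemma op_inv_op (h : IsInverseSemigroup op)
    (a : S) : a ⊚ h.inv a ⊚ a = a := (h.existsUnique_inv a).choose_spec.1.1

lemma inv_op_inv (h : IsInverseSemigroup op) (a : S) : h.inv a ⊚ a ⊚ h.inv a = h.inv a :=
  (h.existsUnique_inv a).choose_spec.1.2

lemma inv_eq_of_op (h : IsInverseSemigroup op)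
    {a b : S} (hab : a ⊚ b ⊚ a = a) (hba : b ⊚ a ⊚ b = b) : h.inv a = b :=
  ((h.existsUnique_inv a).choose_spec.2 b ⟨hab, hba⟩).symm

lemma inv_inv (h : IsInverseSemigroup op)
    (a : S) : h.inv (h.inv a) = a := h.inv_eq_of_op (h.inv_op_inv a) (h.op_inv_op a)

lemma inv_of_idempotent (h : IsInverseSemigroup op) {e : S} (he : e ⊚ e = e) : h.inv e = e :=
  h.inv_eq_of_op (by rw [he, he]) (by rw [he, he])

lemma op_inv_idempotent (h : IsInverseSemigroup op)
    (a : S) : a ⊚ h.inv a ⊚ (a ⊚ h.inv a) = a ⊚ h.inv a := by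
  rw [← h.assoc, h.op_inv_op]

lemma inv_op_idempotent (h : IsInverseSemigroup op)
    (a : S) : h.inv a ⊚ a ⊚ (h.inv a ⊚ a) = h.inv a ⊚ a := by
  rw [← h.assoc, h.inv_op_inv]

/-- If `x` is the inverse of `e ⊚ f`, then so is `f ⊚ x ⊚ e`; hence `x` is idempotent, and so is its
inverse `e ⊚ f`. -/
lemma idempotent_op (h : IsInverseSemigroup op)
    {e f : S} (he : e ⊚ e = e) (hf : f ⊚ f = f) : e ⊚ f ⊚ (e ⊚ f) = e ⊚ f := by
  have h₁ := h.op_inv_op (e ⊚ f)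
  have h₂ := h.inv_op_inv (e ⊚ f)
  have h₃ := h.inv_inv (e ⊚ f)
  set x := h.inv (e ⊚ f)
  have e' (y : S) : e ⊚ (e ⊚ y) = e ⊚ y := by rw [← h.assoc, he]
  have f' (y : S) : f ⊚ (f ⊚ y) = f ⊚ y := by rw [← h.assoc, hf]
  simp only [h.assoc] at h₁ h₂
  have h₂' (y : S) : x ⊚ (e ⊚ (f ⊚ (x ⊚ y))) = x ⊚ y := by
    have := congrArg (fun z => z ⊚ y) h₂
    simpa only [h.assoc] using this
  have hxe : x = f ⊚ (x ⊚ e) :=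
    h.inv_eq_of_op (by simp only [h.assoc, e', f', h₁]) (by simp only [h.assoc, e', f', h₂'])
  have hxx : x ⊚ x = x := by
    nth_rewrite 1 2 [hxe]
    simp only [h.assoc, h₂']
    exact hxe.symm
  rw [h.inv_of_idempotent hxx] at h₃
  rw [← h₃, hxx]

lemma idempotent_comm (h : IsInverseSemigroup op)
    {e f : S} (he : e ⊚ e = e) (hf : f ⊚ f = f) : e ⊚ f = f ⊚ e := by
  have h₁ := h.idempotent_op he hf
  have h₂ := h.idempotent_op hf he
  rw [← h.inv_of_idempotent h₁]
  have e' (y : S) : e ⊚ (e ⊚ y) = e ⊚ y := by rw [← h.assoc, he]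
  have f' (y : S) : f ⊚ (f ⊚ y) = f ⊚ y := by rw [← h.assoc, hf]
  simp only [h.assoc] at h₁ h₂
  exact h.inv_eq_of_op (by simp only [h.assoc, e', f', h₁]) (by simp only [h.assoc, e', f', h₂])

end

/-- A regular semigroup with commuting idempotents is an inverse semigroup. -/
lemma of_regular {S : Type u} {op : S → S → S} (assoc : ∀ a b c, op (op a b) c = op a (op b c))
    (comm : ∀ e f, op e e = e → op f f = f → op e f = op f e)
    (inv : S → S) (h₁ : ∀ a, op (op a (inv a)) a = a)
    (h₂ : ∀ a, op (op (inv a) a) (inv a) = inv a) : IsInverseSemigroup op := by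
  refine ⟨assoc, fun a => ⟨inv a, ⟨h₁ a, h₂ a⟩, ?_⟩⟩
  have key (b c : S) (hb : op (op a b) a = a) (hb' : op (op b a) b = b) (hc : op (op a c) a = a)
      (hc' : op (op c a) c = c) : b = op (op b a) c := by
    have hab : op (op a b) (op a b) = op a b := by rw [← assoc, hb]
    have hac : op (op a c) (op a c) = op a c := by rw [← assoc, hc]
    calc b = op b (op (op a c) (op a b)) := by rw [← assoc (op a c), hc, ← assoc, hb']
      _ = op (op (op b a) b) (op a c) := by rw [comm _ _ hac hab]; simp only [assoc]
      _ = op (op b a) c := by rw [hb', assoc]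
  have key' (b c : S) (hb : op (op a b) a = a) (hb' : op (op b a) b = b) (hc : op (op a c) a = a)
      (hc' : op (op c a) c = c) : c = op (op b a) c := by
    have hba : op (op b a) (op b a) = op b a := by rw [← assoc, hb']
    have hca : op (op c a) (op c a) = op c a := by rw [← assoc, hc']
    calc c = op (op (op c a) (op b a)) c := by rw [assoc c a, ← assoc a b a, hb, hc']
      _ = op (op b a) (op (op c a) c) := by rw [comm _ _ hca hba]; simp only [assoc]
      _ = op (op b a) c := by rw [hc']
  rintro b ⟨hb, hb'⟩
  exact (key b _ hb hb' (h₁ a) (h₂ a)).trans (key' b _ hb hb' (h₁ a) (h₂ a)).symm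

end IsInverseSemigroup

/-! ### Double inverse semigroups are commutative, with equal operations -/

namespace IsDoubleInverseSemigroup

section

variable {S : Type u} {hop vop : S → S → S}

local infixl:70 " ⊚ " => hop

local infixl:70 " ⊙ " => vop

lemma symm (h : IsDoubleInverseSemigroup hop vop) : IsDoubleInverseSemigroup vop hop :=
  ⟨h.vert, h.horiz, fun a b c d => (h.interchange a c b d).symm⟩

lemma horiz_inv_vop (h : IsDoubleInverseSemigroup hop vop)
    (a b : S) : h.horiz.inv (a ⊙ b) = h.horiz.inv a ⊙ h.horiz.inv b :=
  h.horiz.inv_eq_of_op (by simp only [h.interchange, h.horiz.op_inv_op])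
    (by simp only [h.interchange, h.horiz.inv_op_inv])

lemma vert_inv_hop (h : IsDoubleInverseSemigroup hop vop)
    (a b : S) : h.vert.inv (a ⊚ b) = h.vert.inv a ⊚ h.vert.inv b :=
  h.symm.horiz_inv_vop a b

lemma vop_horiz_idempotent (h : IsDoubleInverseSemigroup hop vop)
    {e f : S} (he : e ⊚ e = e) (hf : f ⊚ f = f) :
    e ⊙ f ⊚ (e ⊙ f) = e ⊙ f := by
  rw [h.interchange, he, hf]

/-- On elements which are idempotent for both operations, the operations agree. -/
lemma hop_eq_vop_of_idempotent (h : IsDoubleInverseSemigroup hop vop)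
    {e f : S} (he : e ⊚ e = e) (hf : f ⊚ f = f) (he' : e ⊙ e = e)
    (hf' : f ⊙ f = f) : e ⊚ f = e ⊙ f := by
  have h₁ := h.interchange e f f e
  rw [← h.vert.idempotent_comm he' hf', h.vop_horiz_idempotent he hf,
    ← h.horiz.idempotent_comm he hf, h.symm.vop_horiz_idempotent he' hf'] at h₁
  exact h₁.symm

/-- A horizontal idempotent that lies in a vertical subgroup is the identity of that subgroup. -/
lemma idempotent_vert_of_group (h : IsDoubleInverseSemigroup hop vop) {e : S} (he : e ⊚ e = e)
    (hc : e ⊙ h.vert.inv e = h.vert.inv e ⊙ e) : e ⊙ e = e := by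
  have hi : h.vert.inv e ⊚ h.vert.inv e = h.vert.inv e := by rw [← h.vert_inv_hop, he]
  have hef : e ⊙ (e ⊙ h.vert.inv e) = e := by rw [hc, ← h.vert.assoc, h.vert.op_inv_op]
  have hfe := h.vert.op_inv_op e
  have hf := h.vop_horiz_idempotent he hi
  have hf' := h.vert.op_inv_idempotent e
  set f := e ⊙ h.vert.inv e
  have h₁ : e = e ⊚ f ⊙ (e ⊚ f) := by
    have := h.interchange e f f e
    rwa [hef, hfe, he, h.horiz.idempotent_comm hf he] at this
  have h₂ : e ⊚ f = e := by
    have h₃ : e ⊚ f ⊚ f = e ⊚ f := by rw [h.horiz.assoc, hf]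
    have := h.interchange (e ⊚ f) (e ⊚ f) f f
    rwa [← h₁, hf', h₃, ← h₁] at this
  rw [h₂] at h₁
  exact h₁.symm

/-- Write `f` and `g` for the vertical range and domain idempotents of the horizontal idempotent `e`
and `k` for their meet. Then `e` is the vertical product of `e ⊚ f` and `e ⊚ g`, and each of these
factors is equal to `e ⊚ k = k`. -/
lemma idempotent_vert_of_horiz (h : IsDoubleInverseSemigroup hop vop)
    {e : S} (he : e ⊚ e = e) : e ⊙ e = e := by
  have hi : h.vert.inv e ⊚ h.vert.inv e = h.vert.inv e := by rw [← h.vert_inv_hop, he]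
  have hfe := h.vert.op_inv_op e
  have heg : e ⊙ (h.vert.inv e ⊙ e) = e := by rw [← h.vert.assoc, h.vert.op_inv_op]
  have hf := h.vop_horiz_idempotent he hi
  have hf' := h.vert.op_inv_idempotent e
  have hg := h.vop_horiz_idempotent hi he
  have hg' := h.vert.inv_op_idempotent e
  have hk : e ⊙ h.vert.inv e ⊚ (h.vert.inv e ⊙ e) = _ := h.hop_eq_vop_of_idempotent hf hg hf' hg'
  have hkk := h.horiz.idempotent_op hf hg
  have hkk' := h.symm.vop_horiz_idempotent hf' hg'
  have hw := h.interchange e (h.vert.inv e) (e ⊙ h.vert.inv e ⊚ (h.vert.inv e ⊙ e))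
    (e ⊙ h.vert.inv e ⊚ (h.vert.inv e ⊙ e))
  have hw' := h.interchange (h.vert.inv e) e (e ⊙ h.vert.inv e ⊚ (h.vert.inv e ⊙ e))
    (e ⊙ h.vert.inv e ⊚ (h.vert.inv e ⊙ e))
  rw [hkk'] at hw hw'
  set i := h.vert.inv e
  set f := e ⊙ i
  set g := i ⊙ e
  set k := f ⊚ g
  have hfk : f ⊚ k = k := by rw [← h.horiz.assoc, hf]
  have hgk : g ⊚ k = k := by
    change g ⊚ (f ⊚ g) = f ⊚ g
    rw [h.horiz.idempotent_comm hf hg, ← h.horiz.assoc, hg]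
  have hfk' : f ⊙ k = k := by rw [hk, ← h.vert.assoc, hf']
  have hkg' : k ⊙ g = k := by rw [hk, h.vert.assoc, hg']
  rw [hfk] at hw
  rw [hgk] at hw'
  have hik : h.vert.inv (e ⊚ k) = i ⊚ k := by rw [h.vert_inv_hop, h.vert.inv_of_idempotent hkk']
  have hek : e ⊚ k = k := by
    have h₁ := h.idempotent_vert_of_group (h.horiz.idempotent_op he hkk)
      (by rw [hik, ← hw, ← hw'])
    have h₂ := h.vert.inv_of_idempotent h₁
    calc e ⊚ k = e ⊚ k ⊙ (e ⊚ k) := h₁.symm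
      _ = e ⊚ k ⊙ (i ⊚ k) := by rw [← hik, h₂]
      _ = k := hw.symm
  have hxy : e = e ⊚ f ⊙ (e ⊚ g) := by
    have := h.interchange f e e g
    rwa [hfe, heg, he, h.horiz.idempotent_comm hf he] at this
  have hxf : e ⊚ f ⊚ f = e ⊚ f := by rw [h.horiz.assoc, hf]
  have hyg : e ⊚ g ⊚ g = e ⊚ g := by rw [h.horiz.assoc, hg]
  have hxg : e ⊚ f ⊚ g = k := by rw [h.horiz.assoc, hek]
  have hyf : e ⊚ g ⊚ f = k := by rw [h.horiz.assoc, ← h.horiz.idempotent_comm hf hg, hek]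
  have hx : e ⊚ f = e ⊚ f ⊙ k := by
    have := h.interchange (e ⊚ f) (e ⊚ g) f f
    rwa [← hxy, hf', hxf, hyf] at this
  have hy : e ⊚ g = k ⊙ (e ⊚ g) := by
    have := h.interchange (e ⊚ f) (e ⊚ g) g g
    rwa [← hxy, hg', hxg, hyg] at this
  have hy' : k = e ⊚ g := by
    have := h.interchange (e ⊚ f) (e ⊚ g) k g
    rwa [← hxy, hkg', hek, h.horiz.assoc, hfk, hek, hyg, ← hy] at this
  have hx' : k = e ⊚ f := by
    have := h.interchange (e ⊚ f) (e ⊚ g) f k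
    rwa [← hxy, hfk', hek, hxf, h.horiz.assoc, hgk, hek, ← hx] at this
  rw [← hx', ← hy', hkk'] at hxy
  rw [hxy, hkk']

lemma idempotent_horiz_of_vert (h : IsDoubleInverseSemigroup hop vop)
    {e : S} (he : e ⊙ e = e) : e ⊚ e = e :=
  h.symm.idempotent_vert_of_horiz he

lemma horiz_inv_of_vert_idempotent (h : IsDoubleInverseSemigroup hop vop)
    {e : S} (he : e ⊙ e = e) : h.horiz.inv e = e :=
  h.horiz.inv_of_idempotent (h.idempotent_horiz_of_vert he)

/-- The horizontal range idempotent of `a` lies below the vertical one, because the latter is a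
vertical left identity for `a` and for its horizontal inverse. -/
lemma hop_inv_eq_vop (h : IsDoubleInverseSemigroup hop vop) (a : S) :
    a ⊚ h.horiz.inv a = a ⊙ h.vert.inv a ⊙ (a ⊚ h.horiz.inv a) := by
  have hp := h.vert.op_inv_idempotent a
  have h₁ := h.horiz_inv_of_vert_idempotent hp
  have h₂ : a ⊙ h.vert.inv a ⊙ h.horiz.inv a = h.horiz.inv a := by
    nth_rewrite 1 [← h₁]
    rw [← h.horiz_inv_vop, h.vert.op_inv_op]
  have := h.interchange (a ⊙ h.vert.inv a) a (a ⊙ h.vert.inv a) (h.horiz.inv a)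
  rwa [h₂, h.vert.op_inv_op, h.idempotent_horiz_of_vert hp] at this

lemma hop_inv_eq_vop_inv (h : IsDoubleInverseSemigroup hop vop)
    (a : S) : a ⊚ h.horiz.inv a = a ⊙ h.vert.inv a := by
  have h₁ := h.hop_inv_eq_vop a
  have h₂ : a ⊙ h.vert.inv a = a ⊚ h.horiz.inv a ⊚ (a ⊙ h.vert.inv a) := h.symm.hop_inv_eq_vop a
  have he := h.horiz.op_inv_idempotent a
  have hp := h.vert.op_inv_idempotent a
  have he' := h.idempotent_vert_of_horiz he
  rw [h₁, h.vert.idempotent_comm hp he',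
    ← h.hop_eq_vop_of_idempotent he (h.idempotent_horiz_of_vert hp) he' hp, ← h₂]

/-- Range and domain idempotents agree, so that both semigroups are Clifford semigroups. -/
lemma hop_inv_eq_inv_hop (h : IsDoubleInverseSemigroup hop vop)
    (a : S) : a ⊚ h.horiz.inv a = h.horiz.inv a ⊚ a := by
  have h₁ := h.hop_inv_eq_vop_inv (h.horiz.inv a)
  have hp := h.vert.op_inv_idempotent a
  have h₂ := h.horiz_inv_vop a (h.vert.inv a)
  have h₃ : h.horiz.inv (h.vert.inv a) = h.vert.inv (h.horiz.inv a) :=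
    (h.vert.inv_eq_of_op
      (by simp only [← h.horiz_inv_vop, h.vert.op_inv_op])
      (by simp only [← h.horiz_inv_vop, h.vert.inv_op_inv])).symm
  rw [h.horiz_inv_of_vert_idempotent hp, h₃] at h₂
  rw [h.hop_inv_eq_vop_inv, h₂, ← h₁, h.horiz.inv_inv]

lemma vop_inv_eq_inv_vop (h : IsDoubleInverseSemigroup hop vop)
    (a : S) : a ⊙ h.vert.inv a = h.vert.inv a ⊙ a :=
  h.symm.hop_inv_eq_inv_hop a

/-- An instance of the Eckmann–Hilton argument, with the common range and domain idempotents of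
`a` and `b` in the place of units. -/
lemma hop_eq_vop (h : IsDoubleInverseSemigroup hop vop) (a b : S) : a ⊚ b = a ⊙ b := by
  have hae : a ⊚ (a ⊚ h.horiz.inv a) = a := by
    rw [h.hop_inv_eq_inv_hop, ← h.horiz.assoc, h.horiz.op_inv_op]
  have hea' := h.vert.op_inv_op a
  have hae' : a ⊙ (a ⊙ h.vert.inv a) = a := by
    rw [h.vop_inv_eq_inv_vop, ← h.vert.assoc, h.vert.op_inv_op]
  have hfb := h.horiz.op_inv_op b
  have hfb' := h.vert.op_inv_op b
  rw [← h.hop_inv_eq_vop_inv] at hea' hae' hfb'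
  have he := h.horiz.op_inv_idempotent a
  have hf := h.horiz.op_inv_idempotent b
  set e := a ⊚ h.horiz.inv a
  set f := b ⊚ h.horiz.inv b
  have he' := h.idempotent_vert_of_horiz he
  have hf' := h.idempotent_vert_of_horiz hf
  have hef := h.hop_eq_vop_of_idempotent he hf he' hf'
  have heg : e ⊚ (e ⊚ f) = e ⊚ f := by rw [← h.horiz.assoc, he]
  have heg' : e ⊙ (e ⊚ f) = e ⊚ f := by rw [hef, ← h.vert.assoc, he']
  have hgf : e ⊚ f ⊚ f = e ⊚ f := by rw [h.horiz.assoc, hf]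
  have hgf' : e ⊚ f ⊙ f = e ⊚ f := by rw [hef, h.vert.assoc, hf']
  have hg := h.horiz.idempotent_op he hf
  have ha : a ⊚ (e ⊚ f) = a ⊙ (e ⊚ f) := by
    have := h.interchange a e e (e ⊚ f)
    rwa [hae', heg', hae, heg] at this
  have hb : e ⊚ f ⊚ b = e ⊚ f ⊙ b := by
    have := h.interchange (e ⊚ f) f f b
    rwa [hgf', hfb', hgf, hfb] at this
  have h₁ : a ⊚ f = a ⊙ (e ⊚ f) := by rw [← ha, ← h.horiz.assoc a e f, hae]
  have h₂ : e ⊚ b = e ⊚ f ⊙ b := by rw [← hb, h.horiz.assoc e f b, hfb]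
  have := h.interchange a e f b
  rw [hae', hfb', h₁, h₂] at this
  rw [this, ← h.vert.assoc, h.vert.assoc a, h.idempotent_vert_of_horiz hg, hef,
    ← h.vert.assoc a, hae', h.vert.assoc, hfb']

lemma hop_comm (h : IsDoubleInverseSemigroup hop vop) (a b : S) : a ⊚ b = b ⊚ a := by
  have hop' : vop = hop := by funext x y; exact (h.hop_eq_vop x y).symm
  have medial (x y z w : S) : x ⊚ y ⊚ (z ⊚ w) = x ⊚ z ⊚ (y ⊚ w) := by
    have := h.interchange x y z w
    rwa [hop'] at this
  have central (e x : S) (he : e ⊚ e = e) : e ⊚ x = x ⊚ e := by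
    have h₁ : x ⊚ (x ⊚ h.horiz.inv x) = x := by
      rw [h.hop_inv_eq_inv_hop, ← h.horiz.assoc, h.horiz.op_inv_op]
    have h₂ := h.horiz.op_inv_op x
    have h₃ := h.horiz.op_inv_idempotent x
    set d := x ⊚ h.horiz.inv x
    calc e ⊚ x = e ⊚ d ⊚ x := by rw [h.horiz.assoc, h₂]
      _ = d ⊚ e ⊚ (x ⊚ d) := by rw [h.horiz.idempotent_comm he h₃, h₁]
      _ = x ⊚ (e ⊚ d) := by rw [medial, h₂]
      _ = x ⊚ e := by rw [h.horiz.idempotent_comm he h₃, ← h.horiz.assoc, h₁]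
  have h₁ := h.horiz.op_inv_op a
  have h₂ : b ⊚ (b ⊚ h.horiz.inv b) = b := by
    rw [h.hop_inv_eq_inv_hop, ← h.horiz.assoc, h.horiz.op_inv_op]
  have h₃ := h.horiz.op_inv_idempotent a
  have h₄ := h.horiz.op_inv_idempotent b
  have h₅ : b ⊚ h.horiz.inv b ⊚ b = b := h.horiz.op_inv_op b
  set d := a ⊚ h.horiz.inv a
  set f := b ⊚ h.horiz.inv b
  calc a ⊚ b = d ⊚ a ⊚ (b ⊚ f) := by rw [h₁, h₂]
    _ = d ⊚ b ⊚ (a ⊚ f) := medial _ _ _ _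
    _ = b ⊚ d ⊚ (f ⊚ a) := by rw [central d b h₃, central f a h₄]
    _ = b ⊚ f ⊚ (d ⊚ a) := medial _ _ _ _
    _ = b ⊚ a := by rw [h₂, h₁]

end

end IsDoubleInverseSemigroup

/-! ### The inductive groupoid of a commutative inverse semigroup -/

namespace IsInverseSemigroup

variable {S S' : Type u} {op : S → S → S} {op' : S' → S' → S'}

lemma map_inv (h : IsInverseSemigroup op) (h' : IsInverseSemigroup op') {φ : S → S'}
    (hφ : ∀ a b, φ (op a b) = op' (φ a) (φ b)) (a : S) : φ (h.inv a) = h'.inv (φ a) :=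
  (h'.inv_eq_of_op (by rw [← hφ, ← hφ, h.op_inv_op]) (by rw [← hφ, ← hφ, h.inv_op_inv])).symm

lemma isInductiveFunctor_of_hom (h : IsInverseSemigroup op) (h' : IsInverseSemigroup op')
    {φ : S → S'} (hφ : ∀ a b, φ (op a b) = op' (φ a) (φ b)) :
    IsInductiveFunctor h.groupoidData h'.groupoidData φ where
  map_obj e he := by
    change op' (φ e) (φ e) = φ e
    rw [← hφ, show op e e = e from he]
  map_dom a := by
    change φ (op a (h.inv a)) = op' (φ a) (h'.inv (φ a))
    rw [hφ, h.map_inv h' hφ]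
  map_cod a := by
    change φ (op (h.inv a) a) = op' (h'.inv (φ a)) (φ a)
    rw [hφ, h.map_inv h' hφ]
  map_comp a b _ _ := hφ a b
  map_le := by
    rintro a b ⟨e, he, rfl⟩
    refine ⟨φ e, ?_, hφ e b⟩
    change op' (φ e) (φ e) = φ e
    rw [← hφ, show op e e = e from he]
  map_meet d e _ _ _ _ := hφ d e

section

local infixl:70 " ⊚ " => op

lemma op_op_op_comm (h : IsInverseSemigroup op) (comm : ∀ a b, a ⊚ b = b ⊚ a) (a b c d : S) :
    a ⊚ b ⊚ (c ⊚ d) = a ⊚ c ⊚ (b ⊚ d) := by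
  rw [h.assoc, ← h.assoc b, comm b c, h.assoc, ← h.assoc]

lemma isDoubleInverseSemigroup_self (h : IsInverseSemigroup op) (comm : ∀ a b, a ⊚ b = b ⊚ a) :
    IsDoubleInverseSemigroup op op :=
  ⟨h, h, h.op_op_op_comm comm⟩

lemma inv_op (h : IsInverseSemigroup op) (comm : ∀ a b, a ⊚ b = b ⊚ a) (a b : S) :
    h.inv (a ⊚ b) = h.inv a ⊚ h.inv b :=
  (h.isDoubleInverseSemigroup_self comm).horiz_inv_vop a b

lemma op_op_inv (h : IsInverseSemigroup op) (comm : ∀ a b, a ⊚ b = b ⊚ a) (a b : S) :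
    a ⊚ b ⊚ h.inv (a ⊚ b) = a ⊚ h.inv a ⊚ (b ⊚ h.inv b) := by
  rw [h.inv_op comm, h.op_op_op_comm comm]

lemma inv_op_op (h : IsInverseSemigroup op) (comm : ∀ a b, a ⊚ b = b ⊚ a) (a b : S) :
    h.inv (a ⊚ b) ⊚ (a ⊚ b) = h.inv a ⊚ a ⊚ (h.inv b ⊚ b) := by
  rw [h.inv_op comm, h.op_op_op_comm comm]

lemma eq_op_inv_op_of_le (h : IsInverseSemigroup op) {a b : S} (hab : h.groupoidData.le a b) :
    a = a ⊚ h.inv a ⊚ b := by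
  obtain ⟨e, he, rfl⟩ := hab
  have he : e ⊚ e = e := he
  have h₁ : e ⊚ (e ⊚ b) = e ⊚ b := by rw [← h.assoc, he]
  have h₂ := h.op_inv_idempotent (e ⊚ b)
  have h₃ : e ⊚ b ⊚ h.inv (e ⊚ b) ⊚ e = e ⊚ b ⊚ h.inv (e ⊚ b) := by
    rw [h.idempotent_comm h₂ he, ← h.assoc, h₁]
  nth_rewrite 1 [← h₃]
  rw [h.assoc, h.op_inv_op]

lemma op_eq_of_le_idempotent (h : IsInverseSemigroup op) {a e : S} (he : e ⊚ e = e)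
    (hae : h.groupoidData.le a e) : a ⊚ e = a := by
  obtain ⟨f, hf, rfl⟩ := hae
  rw [h.assoc, he]

lemma isInductiveGroupoid_groupoidData (h : IsInverseSemigroup op)
    (comm : ∀ a b, a ⊚ b = b ⊚ a) : IsInductiveGroupoid h.groupoidData where
  dom_mem a := h.op_inv_idempotent a
  cod_mem a := h.inv_op_idempotent a
  dom_obj e he := by
    change e ⊚ h.inv e = e
    rw [h.inv_of_idempotent he, he]
  cod_obj e he := by
    change h.inv e ⊚ e = e
    rw [h.inv_of_idempotent he, he]
  dom_comp a b hab := by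
    change h.inv a ⊚ a = b ⊚ h.inv b at hab
    change a ⊚ b ⊚ h.inv (a ⊚ b) = a ⊚ h.inv a
    rw [h.op_op_inv comm, ← hab, comm (h.inv a), h.op_inv_idempotent]
  cod_comp a b hab := by
    change h.inv a ⊚ a = b ⊚ h.inv b at hab
    change h.inv (a ⊚ b) ⊚ (a ⊚ b) = h.inv b ⊚ b
    rw [h.inv_op_op comm, hab, comm b, h.inv_op_idempotent]
  id_comp a _ := h.op_inv_op a
  comp_id a _ := (h.assoc _ _ _).symm.trans (h.op_inv_op a)
  assoc a b c _ _ _ _ := h.assoc a b c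
  dom_inv a := by
    change h.inv a ⊚ h.inv (h.inv a) = h.inv a ⊚ a
    rw [h.inv_inv]
  cod_inv a := by
    change h.inv (h.inv a) ⊚ h.inv a = a ⊚ h.inv a
    rw [h.inv_inv]
  comp_inv _ _ := rfl
  inv_comp _ _ := rfl
  le_refl a := ⟨_, h.op_inv_idempotent a, (h.op_inv_op a).symm⟩
  le_trans := by
    rintro _ _ c ⟨e, he, rfl⟩ ⟨f, hf, rfl⟩
    exact ⟨e ⊚ f, h.idempotent_op he hf, (h.assoc e f c).symm⟩
  le_antisymm := by
    rintro a b ⟨e, he, hab⟩ ⟨f, hf, hba⟩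
    have he : e ⊚ e = e := he
    have h₁ : e ⊚ a = a := by rw [hab, ← h.assoc, he]
    rw [hab, hba, ← h.assoc, comm e, h.assoc, h₁]
  inv_le_inv := by
    rintro _ y ⟨e, he, rfl⟩
    refine ⟨e, he, ?_⟩
    change h.inv (e ⊚ y) = e ⊚ h.inv y
    rw [h.inv_op comm, h.inv_of_idempotent he]
  comp_le_comp := by
    rintro _ y _ v _ _ ⟨e, he, rfl⟩ ⟨f, hf, rfl⟩
    exact ⟨e ⊚ f, h.idempotent_op he hf, h.op_op_op_comm comm e y f v⟩
  res_le e x he _ := ⟨e, he, rfl⟩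
  dom_res e x he hex := by
    change e ⊚ x ⊚ h.inv (e ⊚ x) = e
    rw [h.op_op_inv comm, h.inv_of_idempotent he, show e ⊚ e = e from he]
    exact h.op_eq_of_le_idempotent (h.op_inv_idempotent x) hex
  res_unique e x he _ y hyx hy := by
    have h₁ := h.eq_op_inv_op_of_le hyx
    rwa [show y ⊚ h.inv y = e from hy] at h₁
  cores_le x e he _ := ⟨e, he, comm x e⟩
  cod_cores x e he hex := by
    change h.inv (x ⊚ e) ⊚ (x ⊚ e) = e
    rw [comm x e, h.inv_op_op comm, h.inv_of_idempotent he, show e ⊚ e = e from he]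
    exact h.op_eq_of_le_idempotent (h.inv_op_idempotent x) hex
  cores_unique x e he _ y hyx hy := by
    have h₁ := h.eq_op_inv_op_of_le hyx
    rwa [comm y, show h.inv y ⊚ y = e from hy, comm e x] at h₁
  meet_mem e f he hf := h.idempotent_op he hf
  meet_le_left e f he hf := ⟨f, hf, comm e f⟩
  meet_le_right e f he hf := ⟨e, he, rfl⟩
  le_meet e f he hf g hg hge hgf := by
    refine ⟨g, hg, ?_⟩
    change g = g ⊚ (e ⊚ f)
    rw [← h.assoc, h.op_eq_of_le_idempotent he hge, h.op_eq_of_le_idempotent hf hgf]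

lemma isHalfCompatible_groupoidData (h : IsInverseSemigroup op)
    (comm : ∀ a b, a ⊚ b = b ⊚ a) : IsHalfCompatible h.groupoidData h.groupoidData where
  dom_comp a b _ _ := h.op_op_inv comm a b
  cod_comp a b _ _ := h.inv_op_op comm a b
  cores_comp a b f g _ _ _ _ _ _ _ _ _ := h.op_op_op_comm comm a b f g
  res_comp a b f g _ _ _ _ _ _ _ _ _ := h.op_op_op_comm comm f g a b
  meet_comp e f g k _ _ _ _ _ _ _ _ _ := h.op_op_op_comm comm e f g k
  meet_cores e f g k _ _ _ _ _ _ _ _ _ _ _ _ := h.op_op_op_comm comm e f g k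
  meet_res e f g k _ _ _ _ _ _ _ _ _ _ _ _ := h.op_op_op_comm comm f e k g
  dom_meet e f _ _ _ _ := h.op_op_inv comm e f
  cod_meet e f _ _ _ _ := h.inv_op_op comm e f
  dom_cores a e _ _ _ _ := h.op_op_inv comm a e
  cod_cores a e _ _ _ _ := h.inv_op_op comm a e
  dom_res a e _ _ _ _ := h.op_op_inv comm e a
  cod_res a e _ _ _ _ := h.inv_op_op comm e a

lemma isDoubleInductiveGroupoid_groupoidData (h : IsInverseSemigroup op)
    (comm : ∀ a b, a ⊚ b = b ⊚ a) : IsDoubleInductiveGroupoid h.groupoidData h.groupoidData where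
  horiz := h.isInductiveGroupoid_groupoidData comm
  vert := h.isInductiveGroupoid_groupoidData comm
  dom_dom _ := rfl
  dom_cod a := by
    change h.inv a ⊚ a ⊚ h.inv (h.inv a ⊚ a) =
      h.inv (a ⊚ h.inv a) ⊚ (a ⊚ h.inv a)
    rw [comm (h.inv a), comm (h.inv _)]
  cod_dom a := by
    change h.inv (a ⊚ h.inv a) ⊚ (a ⊚ h.inv a) =
      h.inv a ⊚ a ⊚ h.inv (h.inv a ⊚ a)
    rw [comm (h.inv a), comm (h.inv _)]
  cod_cod _ := rfl
  interchange a b c d _ _ _ _ _ _ := h.op_op_op_comm comm a b c d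
  horiz_vert := h.isHalfCompatible_groupoidData comm
  vert_horiz := h.isHalfCompatible_groupoidData comm
  cores_cores a f g x _ _ _ _ _ _ _ _ _ _ _ _ := h.op_op_op_comm comm a f g x
  res_res a f g x _ _ _ _ _ _ _ _ _ _ _ _ := h.op_op_op_comm comm x g f a
  res_cores a f g x _ _ _ _ _ _ _ _ _ _ _ _ := h.op_op_op_comm comm g x a f
  cores_res a f g x _ _ _ _ _ _ _ _ _ _ _ _ := h.op_op_op_comm comm f a x g
  meet_meet e f g k _ _ _ _ _ _ _ _ _ _ _ _ := h.op_op_op_comm comm e f g k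

end

end IsInverseSemigroup

lemma IsDoubleInverseSemigroup.isDoubleInductiveGroupoid {S : Type u} {hop vop : S → S → S}
    (h : IsDoubleInverseSemigroup hop vop) :
    IsDoubleInductiveGroupoid h.horiz.groupoidData h.vert.groupoidData := by
  obtain rfl : hop = vop := funext₂ h.hop_eq_vop
  exact h.horiz.isDoubleInductiveGroupoid_groupoidData h.hop_comm

/-- The product of the inductive groupoid of an inverse semigroup is the semigroup operation. -/
lemma IsInverseSemigroup.prod_groupoidData {S : Type u} {op : S → S → S}
    (h : IsInverseSemigroup op) (hG : IsInductiveGroupoid h.groupoidData) :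
    h.groupoidData.prod hG = op := by
  funext a b
  change op (op a (op (op (h.inv a) a) (op b (h.inv b))))
    (op (op (op (h.inv a) a) (op b (h.inv b))) b) = op a b
  have h₁ := h.idempotent_op (h.inv_op_idempotent a) (h.op_inv_idempotent b)
  have h₂ : op a (op (h.inv a) a) = a := by rw [← h.assoc, h.op_inv_op]
  rw [h.assoc a, ← h.assoc _ _ b, h₁, h.assoc _ _ b, h.op_inv_op, ← h.assoc, h₂]

/-! ### The inverse semigroup of an inductive groupoid -/

namespace InductiveGroupoidData

variable {D : Type u} (G : InductiveGroupoidData D)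

lemma comp_congr {a a' b b' : D} (ha : a = a') (hb : b = b') (h : G.cod a = G.dom b) :
    G.comp a b h = G.comp a' b' (by rw [← ha, ← hb, h]) := by
  subst ha hb; rfl

lemma meet_congr {e e' f f' : D} (he : e = e') (hf : f = f') (h₁ : e ∈ G.obj) (h₂ : f ∈ G.obj) :
    G.meet e f h₁ h₂ = G.meet e' f' (he ▸ h₁) (hf ▸ h₂) := by
  subst he hf; rfl

lemma res_congr {e e' a a' : D} (he : e = e') (ha : a = a') (h₁ : e ∈ G.obj)
    (h₂ : G.le e (G.dom a)) :
    G.res e a h₁ h₂ = G.res e' a' (he ▸ h₁) (by rwa [← he, ← ha]) := by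
  subst he ha; rfl

lemma cores_congr {a a' e e' : D} (ha : a = a') (he : e = e') (h₁ : e ∈ G.obj)
    (h₂ : G.le e (G.cod a)) :
    G.cores a e h₁ h₂ = G.cores a' e' (he ▸ h₁) (by rwa [← he, ← ha]) := by
  subst he ha; rfl

end InductiveGroupoidData

namespace IsInductiveGroupoid

variable {D : Type u} {G : InductiveGroupoidData D}

lemma dom_le_dom (hG : IsInductiveGroupoid G) {a b : D} (h : G.le a b) :
    G.le (G.dom a) (G.dom b) := by
  have := hG.comp_le_comp _ _ _ _ (hG.dom_inv a).symm (hG.dom_inv b).symm h (hG.inv_le_inv _ _ h)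
  rwa [hG.comp_inv, hG.comp_inv] at this

lemma cod_le_cod (hG : IsInductiveGroupoid G) {a b : D} (h : G.le a b) :
    G.le (G.cod a) (G.cod b) := by
  rw [← hG.dom_inv, ← hG.dom_inv]
  exact hG.dom_le_dom (hG.inv_le_inv _ _ h)

/-- A product of `a` and `b` is a composite of restrictions along any cell equal to the meet. -/
lemma prod_eq (hG : IsInductiveGroupoid G) {a b m : D}
    (hm : m = G.meet (G.cod a) (G.dom b) (hG.cod_mem a) (hG.dom_mem b))
    (hmo : m ∈ G.obj) (ha : G.le m (G.cod a)) (hb : G.le m (G.dom b)) :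
    G.prod hG a b = G.comp (G.cores a m hmo ha) (G.res m b hmo hb)
      ((hG.cod_cores _ _ _ _).trans (hG.dom_res _ _ _ _).symm) := by
  subst hm; rfl

lemma exists_prod_eq_comp (hG : IsInductiveGroupoid G) (a b : D) :
    ∃ x y, ∃ h : G.cod x = G.dom y, G.le x a ∧ G.le y b ∧ G.prod hG a b = G.comp x y h :=
  ⟨_, _, _, hG.cores_le _ _ _ _, hG.res_le _ _ _ _, rfl⟩

/-- The product `a ⊗ b` is an upper bound of all composites of arrows below `a` and `b`. -/
lemma comp_le_prod (hG : IsInductiveGroupoid G) {a b x y : D} (h : G.cod x = G.dom y)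
    (hx : G.le x a) (hy : G.le y b) : G.le (G.comp x y h) (G.prod hG a b) := by
  have hm := hG.le_meet _ _ (hG.cod_mem a) (hG.dom_mem b) _ (hG.cod_mem x) (hG.cod_le_cod hx)
    (h ▸ hG.dom_le_dom hy)
  refine hG.comp_le_comp _ _ _ _ _ _ ?_ ?_
  · have hxm := hG.cod_cores a _ (hG.meet_mem _ _ _ _)
      (hG.meet_le_left _ _ (hG.cod_mem a) (hG.dom_mem b))
    rw [← hxm] at hm
    rw [hG.cores_unique a _ (hG.cod_mem x) (hG.cod_le_cod hx) x hx rfl,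
      ← hG.cores_unique a _ (hG.cod_mem x) (hG.cod_le_cod hx) _
        (hG.le_trans _ _ _ (hG.cores_le _ _ (hG.cod_mem x) hm) (hG.cores_le _ _ _ _))
        (hG.cod_cores _ _ _ _)]
    exact hG.cores_le _ _ _ _
  · rw [h] at hm
    have hym := hG.dom_res _ b (hG.meet_mem _ _ _ _)
      (hG.meet_le_right _ _ (hG.cod_mem a) (hG.dom_mem b))
    rw [← hym] at hm
    rw [hG.res_unique _ b (hG.dom_mem y) (hG.dom_le_dom hy) y hy rfl,
      ← hG.res_unique _ b (hG.dom_mem y) (hG.dom_le_dom hy) _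
        (hG.le_trans _ _ _ (hG.res_le _ _ (hG.dom_mem y) hm) (hG.res_le _ _ _ _))
        (hG.dom_res _ _ _ _)]
    exact hG.res_le _ _ _ _

lemma eq_of_le_of_dom_eq (hG : IsInductiveGroupoid G) {x y a : D} (hx : G.le x a) (hy : G.le y a)
    (h : G.dom x = G.dom y) : x = y := by
  rw [hG.res_unique _ a (hG.dom_mem y) (hG.dom_le_dom hy) x hx h]
  exact (hG.res_unique _ a (hG.dom_mem y) (hG.dom_le_dom hy) y hy rfl).symm

lemma eq_of_le_of_cod_eq (hG : IsInductiveGroupoid G) {x y a : D} (hx : G.le x a) (hy : G.le y a)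
    (h : G.cod x = G.cod y) : x = y := by
  rw [hG.cores_unique a _ (hG.cod_mem y) (hG.cod_le_cod hy) x hx h]
  exact (hG.cores_unique a _ (hG.cod_mem y) (hG.cod_le_cod hy) y hy rfl).symm

/-- Arrows below a composite are composites of arrows below the factors. -/
lemma exists_comp_eq_of_le_comp (hG : IsInductiveGroupoid G) {p q z : D} {h : G.cod p = G.dom q}
    (hz : G.le z (G.comp p q h)) :
    ∃ x y, ∃ h' : G.cod x = G.dom y, G.le x p ∧ G.le y q ∧ z = G.comp x y h' := by
  have hp : G.le (G.dom z) (G.dom p) := by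
    have := hG.dom_le_dom hz
    rwa [hG.dom_comp] at this
  have hx := hG.res_le _ p (hG.dom_mem z) hp
  have hq : G.le (G.cod (G.res _ p (hG.dom_mem z) hp)) (G.dom q) := h ▸ hG.cod_le_cod hx
  have hy := hG.res_le _ q (hG.cod_mem _) hq
  have hxy := (hG.dom_res _ q (hG.cod_mem _) hq).symm
  refine ⟨_, _, hxy, hx, hy, hG.eq_of_le_of_dom_eq hz
    (hG.comp_le_comp _ _ _ _ hxy h hx hy) ?_⟩
  rw [hG.dom_comp, hG.dom_res]

lemma exists_comp_eq_of_le_prod (hG : IsInductiveGroupoid G) {a b z : D}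
    (hz : G.le z (G.prod hG a b)) :
    ∃ x y, ∃ h : G.cod x = G.dom y, G.le x a ∧ G.le y b ∧ z = G.comp x y h := by
  obtain ⟨p, q, h, hp, hq, hpq⟩ := hG.exists_prod_eq_comp a b
  rw [hpq] at hz
  obtain ⟨x, y, h', hx, hy, rfl⟩ := hG.exists_comp_eq_of_le_comp hz
  exact ⟨x, y, h', hG.le_trans _ _ _ hx hp, hG.le_trans _ _ _ hy hq, rfl⟩

lemma prod_assoc (hG : IsInductiveGroupoid G) (a b c : D) :
    G.prod hG (G.prod hG a b) c = G.prod hG a (G.prod hG b c) := by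
  apply hG.le_antisymm
  · obtain ⟨p, r, h, hp, hr, hpr⟩ := hG.exists_prod_eq_comp (G.prod hG a b) c
    obtain ⟨x, y, hxy, hx, hy, rfl⟩ := hG.exists_comp_eq_of_le_prod hp
    have hyr : G.cod y = G.dom r := by rw [← h, hG.cod_comp]
    rw [hpr, hG.assoc x y r hxy hyr h (by rw [hG.dom_comp, hxy])]
    exact hG.comp_le_prod _ hx (hG.comp_le_prod _ hy hr)
  · obtain ⟨x, p, h, hx, hp, hxp⟩ := hG.exists_prod_eq_comp a (G.prod hG b c)
    obtain ⟨y, r, hyr, hy, hr, rfl⟩ := hG.exists_comp_eq_of_le_prod hp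
    have hxy : G.cod x = G.dom y := by rw [h, hG.dom_comp]
    rw [hxp, ← hG.assoc x y r hxy hyr (by rw [hG.cod_comp, hyr]) h]
    exact hG.comp_le_prod _ (hG.comp_le_prod _ hx hy) hr

lemma res_dom (hG : IsInductiveGroupoid G) (a : D) (h : G.dom a ∈ G.obj)
    (h' : G.le (G.dom a) (G.dom a)) : G.res (G.dom a) a h h' = a :=
  (hG.res_unique _ _ _ _ a (hG.le_refl a) rfl).symm

lemma cores_cod (hG : IsInductiveGroupoid G) (a : D) (h : G.cod a ∈ G.obj)
    (h' : G.le (G.cod a) (G.cod a)) : G.cores a (G.cod a) h h' = a :=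
  (hG.cores_unique _ _ _ _ a (hG.le_refl a) rfl).symm

lemma mem_obj_of_le (hG : IsInductiveGroupoid G) {x e : D} (he : e ∈ G.obj) (h : G.le x e) :
    x ∈ G.obj := by
  have h₁ : G.le (G.dom x) e := by
    have := hG.dom_le_dom h
    rwa [hG.dom_obj e he] at this
  rw [hG.eq_of_le_of_dom_eq h h₁ (hG.dom_obj _ (hG.dom_mem x)).symm]
  exact hG.dom_mem x

lemma meet_eq_of_le (hG : IsInductiveGroupoid G) {e f : D} (he : e ∈ G.obj) (hf : f ∈ G.obj)
    (h : G.le e f) : G.meet e f he hf = e :=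
  hG.le_antisymm _ _ (hG.meet_le_left _ _ _ _)
    (hG.le_meet _ _ _ _ _ he (hG.le_refl e) h)

lemma meet_eq_of_ge (hG : IsInductiveGroupoid G) {e f : D} (he : e ∈ G.obj) (hf : f ∈ G.obj)
    (h : G.le f e) : G.meet e f he hf = f :=
  hG.le_antisymm _ _ (hG.meet_le_right _ _ _ _)
    (hG.le_meet _ _ _ _ _ hf h (hG.le_refl f))

lemma meet_comm (hG : IsInductiveGroupoid G) {e f : D} (he : e ∈ G.obj) (hf : f ∈ G.obj) :
    G.meet e f he hf = G.meet f e hf he :=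
  hG.le_antisymm _ _
    (hG.le_meet _ _ _ _ _ (hG.meet_mem _ _ _ _) (hG.meet_le_right _ _ _ _)
      (hG.meet_le_left _ _ _ _))
    (hG.le_meet _ _ _ _ _ (hG.meet_mem _ _ _ _) (hG.meet_le_right _ _ _ _)
      (hG.meet_le_left _ _ _ _))

/-- On composable arrows, the product is the composite. -/
lemma prod_eq_comp (hG : IsInductiveGroupoid G) {a b : D} (h : G.cod a = G.dom b) :
    G.prod hG a b = G.comp a b h := by
  have hl : G.le (G.cod a) (G.dom b) := h ▸ hG.le_refl _
  rw [hG.prod_eq (hG.meet_eq_of_le _ _ hl).symm (hG.cod_mem a) (hG.le_refl _) hl]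
  refine G.comp_congr (hG.cores_cod a _ _) ?_ _
  rw [G.res_congr h rfl, hG.res_dom]

lemma prod_eq_res (hG : IsInductiveGroupoid G) {e a : D} (he : e ∈ G.obj) (h : G.le e (G.dom a)) :
    G.prod hG e a = G.res e a he h := by
  have hc := hG.cod_obj e he
  have hl : G.le e (G.cod e) := hc.symm ▸ hG.le_refl e
  have hm : e = G.meet (G.cod e) (G.dom a) (hG.cod_mem e) (hG.dom_mem a) := by
    rw [G.meet_congr hc rfl, hG.meet_eq_of_le _ _ h]
  rw [hG.prod_eq hm he hl h]
  have h₁ : G.cores e e he hl = G.dom (G.res e a he h) :=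
    ((hG.cores_unique e e he hl e (hG.le_refl e) hc).symm).trans (hG.dom_res e a he h).symm
  rw [G.comp_congr h₁ rfl, hG.id_comp]

lemma prod_eq_cores (hG : IsInductiveGroupoid G) {e a : D} (he : e ∈ G.obj)
    (h : G.le e (G.cod a)) : G.prod hG a e = G.cores a e he h := by
  have hd := hG.dom_obj e he
  have hl : G.le e (G.dom e) := hd.symm ▸ hG.le_refl e
  have hm : e = G.meet (G.cod a) (G.dom e) (hG.cod_mem a) (hG.dom_mem e) := by
    rw [G.meet_congr rfl hd, hG.meet_eq_of_ge _ _ h]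
  rw [hG.prod_eq hm he h hl]
  have h₁ : G.res e e he hl = G.cod (G.cores a e he h) :=
    ((hG.res_unique e e he hl e (hG.le_refl e) hd).symm).trans (hG.cod_cores a e he h).symm
  rw [G.comp_congr rfl h₁, hG.comp_id]

lemma prod_eq_meet (hG : IsInductiveGroupoid G) {e f : D} (he : e ∈ G.obj) (hf : f ∈ G.obj) :
    G.prod hG e f = G.meet e f he hf := by
  have h₁ : G.le (G.meet e f he hf) (G.cod e) := by
    rw [hG.cod_obj e he]; exact hG.meet_le_left _ _ _ _
  have h₂ : G.le (G.meet e f he hf) (G.dom f) := by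
    rw [hG.dom_obj f hf]; exact hG.meet_le_right _ _ _ _
  have hm := hG.meet_mem e f he hf
  rw [hG.prod_eq (G.meet_congr (hG.cod_obj e he).symm (hG.dom_obj f hf).symm _ _) hm h₁ h₂]
  have h₃ : G.cores e _ hm h₁ = G.meet e f he hf :=
    (hG.cores_unique _ _ _ _ _ (hG.meet_le_left _ _ _ _) (hG.cod_obj _ hm)).symm
  have h₄ : G.res _ f hm h₂ = G.dom (G.meet e f he hf) :=
    ((hG.res_unique _ _ _ _ _ (hG.meet_le_right _ _ _ _) (hG.dom_obj _ hm)).symm).trans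
      (hG.dom_obj _ hm).symm
  have h₅ : G.cores e _ hm h₁ = G.dom (G.meet e f he hf) := h₃.trans (hG.dom_obj _ hm).symm
  rw [G.comp_congr h₅ (h₄.trans (hG.dom_obj _ hm)), hG.id_comp]

lemma prod_self_iff (hG : IsInductiveGroupoid G) {a : D} : G.prod hG a a = a ↔ a ∈ G.obj := by
  refine ⟨fun h => ?_, fun h => by
    rw [hG.prod_eq_meet h h, hG.meet_eq_of_le h h (hG.le_refl a)]⟩
  obtain ⟨x, y, hxy, hx, hy, hp⟩ := hG.exists_prod_eq_comp a a
  rw [h] at hp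
  have hxa : x = a := hG.eq_of_le_of_dom_eq hx (hG.le_refl a) (by rw [hp, hG.dom_comp])
  have hya : y = a := hG.eq_of_le_of_cod_eq hy (hG.le_refl a) (by
    conv_rhs => rw [hp, hG.cod_comp])
  subst hxa
  subst hya
  have hi := hG.comp_inv y (hG.dom_inv y).symm
  -- Cancel `y` in `y = y ; y`.
  have h₁ := hG.assoc y y (G.inv y) hxy (hG.dom_inv y).symm
    (by rw [hG.cod_comp, hG.dom_inv]) (by rw [hG.dom_comp, hxy])
  rw [G.comp_congr hp.symm rfl, G.comp_congr rfl (hi.trans hxy.symm), hG.comp_id, hi] at h₁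
  rw [← h₁]
  exact hG.dom_mem y

lemma prod_inv_self (hG : IsInductiveGroupoid G) (a : D) : G.prod hG a (G.inv a) = G.dom a := by
  rw [hG.prod_eq_comp (hG.dom_inv a).symm, hG.comp_inv]

lemma inv_prod_self (hG : IsInductiveGroupoid G) (a : D) : G.prod hG (G.inv a) a = G.cod a := by
  rw [hG.prod_eq_comp (hG.cod_inv a), hG.inv_comp]

lemma dom_prod_self (hG : IsInductiveGroupoid G) (a : D) : G.prod hG (G.dom a) a = a := by
  rw [hG.prod_eq_res (hG.dom_mem a) (hG.le_refl _), hG.res_dom]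

lemma prod_inv_prod (hG : IsInductiveGroupoid G) (a : D) :
    G.prod hG (G.prod hG a (G.inv a)) a = a := by
  rw [hG.prod_inv_self, hG.dom_prod_self]

lemma inv_prod_inv (hG : IsInductiveGroupoid G) (a : D) :
    G.prod hG (G.prod hG (G.inv a) a) (G.inv a) = G.inv a := by
  rw [hG.inv_prod_self, ← hG.dom_inv, hG.dom_prod_self]

lemma isInverseSemigroup_prod (hG : IsInductiveGroupoid G) :
    IsInverseSemigroup (G.prod hG) := by
  refine .of_regular hG.prod_assoc (fun e f he hf => ?_) G.inv hG.prod_inv_prod hG.inv_prod_inv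
  rw [hG.prod_self_iff] at he hf
  rw [hG.prod_eq_meet he hf, hG.prod_eq_meet hf he, hG.meet_comm]

lemma inv_prod (hG : IsInductiveGroupoid G) (a : D) :
    hG.isInverseSemigroup_prod.inv a = G.inv a :=
  hG.isInverseSemigroup_prod.inv_eq_of_op (hG.prod_inv_prod a) (hG.inv_prod_inv a)

lemma le_iff_exists_prod (hG : IsInductiveGroupoid G) {a b : D} :
    G.le a b ↔ ∃ e ∈ idempotents (G.prod hG), a = G.prod hG e b := by
  constructor
  · intro h
    refine ⟨G.dom a, hG.prod_self_iff.2 (hG.dom_mem a), ?_⟩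
    rw [hG.prod_eq_res (hG.dom_mem a) (hG.dom_le_dom h)]
    exact hG.res_unique _ _ _ _ _ h rfl
  · rintro ⟨e, he, rfl⟩
    have he := hG.prod_self_iff.1 he
    obtain ⟨x, y, h, hx, hy, hp⟩ := hG.exists_prod_eq_comp e b
    have hx' := hG.mem_obj_of_le he hx
    rw [hp, G.comp_congr (show x = G.dom y by rw [← h, hG.cod_obj x hx']) rfl, hG.id_comp]
    exact hy

end IsInductiveGroupoid

/-- Extensionality for inductive groupoid data, with the partially defined operations compared only
where they are defined. -/
lemma InductiveGroupoidData.ext_of_forall {D : Type u} {G G' : InductiveGroupoidData D}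
    (obj : G.obj = G'.obj) (dom : G.dom = G'.dom) (cod : G.cod = G'.cod)
    (inv : G.inv = G'.inv) (le : G.le = G'.le)
    (comp : ∀ a b h h', G.comp a b h = G'.comp a b h')
    (meet : ∀ e f he hf he' hf', G.meet e f he hf = G'.meet e f he' hf')
    (res : ∀ e a he h he' h', G.res e a he h = G'.res e a he' h')
    (cores : ∀ a e he h he' h', G.cores a e he h = G'.cores a e he' h') : G = G' := by
  cases G
  cases G'
  dsimp only at *
  subst obj dom cod inv le
  congr
  · funext a b h; exact comp _ _ _ _
  · funext e f he hf; exact meet _ _ _ _ _ _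
  · funext e a he h; exact res _ _ _ _ _ _
  · funext a e he h; exact cores _ _ _ _ _ _

/-- An inductive groupoid is recovered from its inverse semigroup. -/
lemma IsInductiveGroupoid.groupoidData_prod {D : Type u} {G : InductiveGroupoidData D}
    (hG : IsInductiveGroupoid G) (h : IsInverseSemigroup (G.prod hG)) : h.groupoidData = G := by
  have hinv : h.inv = G.inv := funext hG.inv_prod
  refine InductiveGroupoidData.ext_of_forall (Set.ext fun a => hG.prod_self_iff) ?_ ?_ hinv ?_
    (fun a b _ h' => hG.prod_eq_comp h') (fun e f _ _ he hf => hG.prod_eq_meet he hf)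
    (fun e a _ _ he h' => hG.prod_eq_res he h') (fun a e _ _ he h' => hG.prod_eq_cores he h')
  · funext a
    change G.prod hG a (h.inv a) = _
    rw [hinv, hG.prod_inv_self]
  · funext a
    change G.prod hG (h.inv a) a = _
    rw [hinv, hG.inv_prod_self]
  · funext a b
    exact propext hG.le_iff_exists_prod.symm

lemma IsInductiveFunctor.map_prod {D D' : Type u} {G : InductiveGroupoidData D}
    {G' : InductiveGroupoidData D'} {f : D → D'} (hf : IsInductiveFunctor G G' f)
    (hG : IsInductiveGroupoid G) (hG' : IsInductiveGroupoid G') (a b : D) :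
    f (G.prod hG a b) = G'.prod hG' (f a) (f b) := by
  have hm := hG.meet_mem _ _ (hG.cod_mem a) (hG.dom_mem b)
  have hma := hG.meet_le_left _ _ (hG.cod_mem a) (hG.dom_mem b)
  have hmb := hG.meet_le_right _ _ (hG.cod_mem a) (hG.dom_mem b)
  have hma' := hf.map_le _ _ hma
  have hmb' := hf.map_le _ _ hmb
  rw [hf.map_cod] at hma'
  rw [hf.map_dom] at hmb'
  rw [hG'.prod_eq (m := f (G.meet _ _ (hG.cod_mem a) (hG.dom_mem b))) ?_ (hf.map_obj _ hm) hma'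
      hmb',
    G'.comp_congr
      (hG'.cores_unique _ _ _ hma' (f (G.cores a _ hm hma)) (hf.map_le _ _ (hG.cores_le _ _ _ _))
        (by rw [← hf.map_cod, hG.cod_cores])).symm
      (hG'.res_unique _ _ _ hmb' (f (G.res _ b hm hmb)) (hf.map_le _ _ (hG.res_le _ _ _ _))
        (by rw [← hf.map_dom, hG.dom_res])).symm]
  · exact hf.map_comp _ _ _ _
  · rw [hf.map_meet _ _ _ _ (hf.map_obj _ (hG.cod_mem a)) (hf.map_obj _ (hG.dom_mem b)),
      G'.meet_congr (hf.map_cod a) (hf.map_dom b)]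

/-! ### Inductive functors and partial binary operations -/

lemma IsInductiveGroupoid.mem_obj_iff_dom_eq {D : Type u} {G : InductiveGroupoidData D}
    (hG : IsInductiveGroupoid G) {a : D} : a ∈ G.obj ↔ G.dom a = a :=
  ⟨hG.dom_obj a, fun h => h ▸ hG.dom_mem a⟩

lemma IsInductiveGroupoid.le_of_meet_eq {D : Type u} {G : InductiveGroupoidData D}
    (hG : IsInductiveGroupoid G) {e f : D} (he : e ∈ G.obj) (hf : f ∈ G.obj)
    (h : G.meet e f he hf = e) : G.le e f := by
  have := hG.meet_le_right e f he hf
  rwa [h] at this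

lemma IsInductiveGroupoid.prod_eq_comp_of_le {D : Type u} {G : InductiveGroupoidData D}
    (hG : IsInductiveGroupoid G) {a b x y : D} (h : G.cod x = G.dom y) (hx : G.le x a)
    (hy : G.le y b)
    (hm : G.cod x = G.meet (G.cod a) (G.dom b) (hG.cod_mem a) (hG.dom_mem b)) :
    G.prod hG a b = G.comp x y h := by
  have hb : G.le (G.cod x) (G.dom b) := h ▸ hG.dom_le_dom hy
  rw [hG.prod_eq hm (hG.cod_mem x) (hG.cod_le_cod hx) hb]
  exact G.comp_congr (hG.cores_unique _ _ _ _ x hx rfl).symm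
    (hG.res_unique _ _ _ _ y hy h.symm).symm _

/-- A partial binary operation `f` on the arrows of an inductive groupoid, defined on the pairs in
`P`, is an inductive operation if `P` is closed under all the operations on pairs of arrows and `f`
is functorial in these pairs and preserves the meets of objects and corestrictions. -/
structure IsInductiveOperation {D : Type u} (G : InductiveGroupoidData D) (P : D → D → Prop)
    (f : ∀ a b, P a b → D) : Prop where
  dom : ∀ a b, P a b → P (G.dom a) (G.dom b)
  cod : ∀ a b, P a b → P (G.cod a) (G.cod b)
  comp : ∀ a b c d hac hbd, P a b → P c d → P (G.comp a c hac) (G.comp b d hbd)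
  meet : ∀ a b c d ha hb hc hd, P a b → P c d → P (G.meet a c ha hc) (G.meet b d hb hd)
  cores : ∀ a b e k he hea hk hkb, P a b → P e k → P (G.cores a e he hea) (G.cores b k hk hkb)
  res : ∀ a b e k he hea hk hkb, P a b → P e k → P (G.res e a he hea) (G.res k b hk hkb)
  map_dom : ∀ a b h h', G.dom (f a b h) = f (G.dom a) (G.dom b) h'
  map_cod : ∀ a b h h', G.cod (f a b h) = f (G.cod a) (G.cod b) h'
  map_comp : ∀ a b c d hac hbd h₁ h₂ h₃ h₄,
    f (G.comp a c hac) (G.comp b d hbd) h₃ = G.comp (f a b h₁) (f c d h₂) h₄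
  map_meet : ∀ a b c d ha hb hc hd h₁ h₂ h₃ h₄ h₅,
    f (G.meet a c ha hc) (G.meet b d hb hd) h₃ = G.meet (f a b h₁) (f c d h₂) h₄ h₅
  map_cores : ∀ a b e k he hea hk hkb h₁ h₂ h₃ h₄ h₅,
    f (G.cores a e he hea) (G.cores b k hk hkb) h₃ = G.cores (f a b h₁) (f e k h₂) h₄ h₅

namespace IsInductiveOperation

variable {D : Type u} {G : InductiveGroupoidData D} {P : D → D → Prop} {f : ∀ a b, P a b → D}

lemma map_mem_obj (hf : IsInductiveOperation G P f) (hG : IsInductiveGroupoid G) {e k : D}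
    (he : e ∈ G.obj) (hk : k ∈ G.obj) (h : P e k) : f e k h ∈ G.obj := by
  rw [hG.mem_obj_iff_dom_eq, hf.map_dom _ _ _ (hf.dom _ _ h)]
  simp only [hG.dom_obj e he, hG.dom_obj k hk]

/-- On objects, monotonicity follows from the preservation of meets; on arrows it then follows from
the preservation of corestrictions. -/
lemma map_le (hf : IsInductiveOperation G P f) (hG : IsInductiveGroupoid G) {a b a' b' : D}
    (h : P a b) (h' : P a' b') (ha : G.le a a') (hb : G.le b b') :
    G.le (f a b h) (f a' b' h') := by
  have hca := hG.cod_le_cod ha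
  have hcb := hG.cod_le_cod hb
  have hc := hf.cod _ _ h
  have hc' := hf.cod _ _ h'
  have ho := hf.map_mem_obj hG (hG.cod_mem a) (hG.cod_mem b) hc
  have ho' := hf.map_mem_obj hG (hG.cod_mem a') (hG.cod_mem b') hc'
  have hl : G.le (f _ _ hc) (G.cod (f a' b' h')) := by
    have hm := hf.map_meet _ _ _ _ (hG.cod_mem a) (hG.cod_mem b) (hG.cod_mem a') (hG.cod_mem b')
      hc hc' (hf.meet _ _ _ _ _ _ _ _ hc hc') ho ho'
    simp only [hG.meet_eq_of_le _ _ hca, hG.meet_eq_of_le _ _ hcb] at hm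
    rw [hm, hf.map_cod _ _ h' hc']
    exact hG.meet_le_right _ _ _ _
  have hm := hf.map_cores a' b' _ _ (hG.cod_mem a) hca (hG.cod_mem b) hcb h' hc
    (hf.cores _ _ _ _ _ _ _ _ h' hc) ho hl
  simp only [← hG.cores_unique _ _ (hG.cod_mem a) hca a ha rfl,
    ← hG.cores_unique _ _ (hG.cod_mem b) hcb b hb rfl] at hm
  rw [hm]
  exact hG.cores_le _ _ _ _

lemma map_res (hf : IsInductiveOperation G P f) (hG : IsInductiveGroupoid G) {a b e k : D}
    (he : e ∈ G.obj) (hea : G.le e (G.dom a)) (hk : k ∈ G.obj) (hkb : G.le k (G.dom b))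
    (h₁ : P a b) (h₂ : P e k) (h₃ : P (G.res e a he hea) (G.res k b hk hkb))
    (h₄ : f e k h₂ ∈ G.obj) (h₅ : G.le (f e k h₂) (G.dom (f a b h₁))) :
    f (G.res e a he hea) (G.res k b hk hkb) h₃ = G.res (f e k h₂) (f a b h₁) h₄ h₅ := by
  refine hG.res_unique _ _ _ _ _
    (hf.map_le hG _ _ (hG.res_le _ _ _ _) (hG.res_le _ _ _ _)) ?_
  rw [hf.map_dom _ _ _ (hf.dom _ _ h₃)]
  simp only [hG.dom_res]

lemma prod (hf : IsInductiveOperation G P f) (hG : IsInductiveGroupoid G) {a b c d : D}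
    (h₁ : P a b) (h₂ : P c d) : P (G.prod hG a c) (G.prod hG b d) := by
  have hm := hf.meet _ _ _ _ (hG.cod_mem a) (hG.cod_mem b) (hG.dom_mem c) (hG.dom_mem d)
    (hf.cod _ _ h₁) (hf.dom _ _ h₂)
  exact hf.comp _ _ _ _ _ _ (hf.cores _ _ _ _ _ _ _ _ h₁ hm) (hf.res _ _ _ _ _ _ _ _ h₂ hm)

lemma map_prod (hf : IsInductiveOperation G P f) (hG : IsInductiveGroupoid G) {a b c d : D}
    (h₁ : P a b) (h₂ : P c d) (h₃ : P (G.prod hG a c) (G.prod hG b d)) :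
    f (G.prod hG a c) (G.prod hG b d) h₃ = G.prod hG (f a b h₁) (f c d h₂) := by
  have hm := hf.meet _ _ _ _ (hG.cod_mem a) (hG.cod_mem b) (hG.dom_mem c) (hG.dom_mem d)
    (hf.cod _ _ h₁) (hf.dom _ _ h₂)
  have hx := hf.cores _ _ _ _ (hG.meet_mem _ _ _ _)
    (hG.meet_le_left _ _ (hG.cod_mem a) (hG.dom_mem c)) (hG.meet_mem _ _ _ _)
    (hG.meet_le_left _ _ (hG.cod_mem b) (hG.dom_mem d)) h₁ hm
  have hy := hf.res _ _ _ _ (hG.meet_mem _ _ _ _)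
    (hG.meet_le_right _ _ (hG.cod_mem a) (hG.dom_mem c)) (hG.meet_mem _ _ _ _)
    (hG.meet_le_right _ _ (hG.cod_mem b) (hG.dom_mem d)) h₂ hm
  have hcx : G.cod (f _ _ hx) = f _ _ hm := by
    rw [hf.map_cod _ _ _ (hf.cod _ _ hx)]
    simp only [hG.cod_cores]
  have hdy : G.dom (f _ _ hy) = f _ _ hm := by
    rw [hf.map_dom _ _ _ (hf.dom _ _ hy)]
    simp only [hG.dom_res]
  rw [hG.prod_eq_comp_of_le (hcx.trans hdy.symm)
    (hf.map_le hG hx h₁ (hG.cores_le _ _ _ _) (hG.cores_le _ _ _ _))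
    (hf.map_le hG hy h₂ (hG.res_le _ _ _ _) (hG.res_le _ _ _ _))]
  · exact hf.map_comp _ _ _ _ _ _ _ _ _ _
  · have h₄ := hf.map_cod _ _ h₁ (hf.cod _ _ h₁)
    have h₅ := hf.map_dom _ _ h₂ (hf.dom _ _ h₂)
    rw [hcx, hf.map_meet _ _ _ _ _ _ _ _ (hf.cod _ _ h₁) (hf.dom _ _ h₂) _
      (h₄ ▸ hG.cod_mem _) (h₅ ▸ hG.dom_mem _)]
    exact G.meet_congr h₄.symm h₅.symm _ _

end IsInductiveOperation

/-! ### The horizontal operations of a double inductive groupoid are vertically inductive -/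

namespace IsDoubleInductiveGroupoid

variable {D : Type u} {H V : InductiveGroupoidData D}

lemma symm (h : IsDoubleInductiveGroupoid H V) : IsDoubleInductiveGroupoid V H where
  horiz := h.vert
  vert := h.horiz
  dom_dom a := (h.dom_dom a).symm
  dom_cod a := (h.cod_dom a).symm
  cod_dom a := (h.dom_cod a).symm
  cod_cod a := (h.cod_cod a).symm
  interchange a b c d _ _ _ _ _ _ := (h.interchange a c b d _ _ _ _ _ _).symm
  horiz_vert := h.vert_horiz
  vert_horiz := h.horiz_vert
  cores_cores a f g x hf hfa hg hga hx hx' hxf hxg _ _ _ _ :=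
    (h.cores_cores a g f x hg hga hf hfa hx' hx hxg hxf _ _ _ _).symm
  res_res a f g x hf hfa hg hga hx hx' hxf hxg _ _ _ _ :=
    (h.res_res a g f x hg hga hf hfa hx' hx hxg hxf _ _ _ _).symm
  res_cores a f g x hf hfa hg hga hx hx' hxf hxg _ _ _ _ :=
    (h.cores_res a g f x hg hga hf hfa hx' hx hxg hxf _ _ _ _).symm
  cores_res a f g x hf hfa hg hga hx hx' hxf hxg _ _ _ _ :=
    (h.res_cores a g f x hg hga hf hfa hx' hx hxg hxf _ _ _ _).symm
  meet_meet e f g k he hf hg hk he' hf' hg' hk' _ _ _ _ :=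
    (h.meet_meet e g f k he' hg' hf' hk' he hg hf hk _ _ _ _).symm

lemma dom_mem_vert (h : IsDoubleInductiveGroupoid H V) {e : D} (he : e ∈ V.obj) :
    H.dom e ∈ V.obj := by
  rw [h.vert.mem_obj_iff_dom_eq, h.dom_dom, h.vert.dom_obj e he]

lemma cod_mem_vert (h : IsDoubleInductiveGroupoid H V) {e : D} (he : e ∈ V.obj) :
    H.cod e ∈ V.obj := by
  rw [h.vert.mem_obj_iff_dom_eq, h.dom_cod, h.vert.dom_obj e he]

/-- Monotonicity on objects holds because meets are preserved; on an arrow `a ≤ b` it then follows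
by writing `a` as a corestriction of `b`. -/
lemma isInductiveFunctor_dom (h : IsDoubleInductiveGroupoid H V) :
    IsInductiveFunctor V V H.dom where
  map_obj e he := h.dom_mem_vert he
  map_dom a := (h.dom_dom a).symm
  map_cod a := (h.cod_dom a).symm
  map_comp := h.vert_horiz.dom_comp
  map_meet := h.vert_horiz.dom_meet
  map_le a b hab := by
    have hc := h.vert.cod_le_cod hab
    have hm := h.vert_horiz.dom_meet (V.cod a) (V.cod b) (h.vert.cod_mem a) (h.vert.cod_mem b)
      (h.dom_mem_vert (h.vert.cod_mem a)) (h.dom_mem_vert (h.vert.cod_mem b))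
    rw [h.vert.meet_eq_of_le _ _ hc] at hm
    have hl : V.le (H.dom (V.cod a)) (V.cod (H.dom b)) := by
      rw [hm, h.cod_dom]
      exact h.vert.meet_le_right _ _ _ _
    rw [h.vert.cores_unique b _ (h.vert.cod_mem a) hc a hab rfl,
      h.vert_horiz.dom_cores _ _ _ _ (h.dom_mem_vert (h.vert.cod_mem a)) hl]
    exact h.vert.cores_le _ _ _ _

lemma isInductiveFunctor_cod (h : IsDoubleInductiveGroupoid H V) :
    IsInductiveFunctor V V H.cod where
  map_obj e he := h.cod_mem_vert he
  map_dom a := (h.dom_cod a).symm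
  map_cod a := (h.cod_cod a).symm
  map_comp := h.vert_horiz.cod_comp
  map_meet := h.vert_horiz.cod_meet
  map_le a b hab := by
    have hc := h.vert.cod_le_cod hab
    have hm := h.vert_horiz.cod_meet (V.cod a) (V.cod b) (h.vert.cod_mem a) (h.vert.cod_mem b)
      (h.cod_mem_vert (h.vert.cod_mem a)) (h.cod_mem_vert (h.vert.cod_mem b))
    rw [h.vert.meet_eq_of_le _ _ hc] at hm
    have hl : V.le (H.cod (V.cod a)) (V.cod (H.cod b)) := by
      rw [hm, h.cod_cod]
      exact h.vert.meet_le_right _ _ _ _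
    rw [h.vert.cores_unique b _ (h.vert.cod_mem a) hc a hab rfl,
      h.vert_horiz.cod_cores _ _ _ _ (h.cod_mem_vert (h.vert.cod_mem a)) hl]
    exact h.vert.cores_le _ _ _ _

lemma comp_mem_horiz (h : IsDoubleInductiveGroupoid H V) {a b : D} (hab : V.cod a = V.dom b)
    (ha : a ∈ H.obj) (hb : b ∈ H.obj) : V.comp a b hab ∈ H.obj := by
  have ha' := h.horiz.dom_obj a ha
  have hb' := h.horiz.dom_obj b hb
  rw [h.horiz.mem_obj_iff_dom_eq, h.vert_horiz.dom_comp a b hab (by rw [ha', hb', hab])]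
  exact V.comp_congr ha' hb' _

lemma meet_mem_horiz (h : IsDoubleInductiveGroupoid H V) {a b : D} (ha' : a ∈ V.obj)
    (hb' : b ∈ V.obj) (ha : a ∈ H.obj) (hb : b ∈ H.obj) : V.meet a b ha' hb' ∈ H.obj := by
  rw [h.horiz.mem_obj_iff_dom_eq,
    h.vert_horiz.dom_meet a b _ _ (h.dom_mem_vert ha') (h.dom_mem_vert hb')]
  exact V.meet_congr (h.horiz.dom_obj a ha) (h.horiz.dom_obj b hb) _ _

lemma cores_mem_horiz (h : IsDoubleInductiveGroupoid H V) {a e : D} (he' : e ∈ V.obj)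
    (hea : V.le e (V.cod a)) (ha : a ∈ H.obj) (he : e ∈ H.obj) : V.cores a e he' hea ∈ H.obj := by
  have ha₁ := h.horiz.dom_obj a ha
  have he₁ := h.horiz.dom_obj e he
  rw [h.horiz.mem_obj_iff_dom_eq, h.vert_horiz.dom_cores a e he' hea (by rwa [he₁])
    (by rwa [he₁, ha₁])]
  exact V.cores_congr ha₁ he₁ _ _

lemma res_mem_horiz (h : IsDoubleInductiveGroupoid H V) {a e : D} (he' : e ∈ V.obj)
    (hea : V.le e (V.dom a)) (ha : a ∈ H.obj) (he : e ∈ H.obj) : V.res e a he' hea ∈ H.obj := by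
  have ha₁ := h.horiz.dom_obj a ha
  have he₁ := h.horiz.dom_obj e he
  rw [h.horiz.mem_obj_iff_dom_eq, h.vert_horiz.dom_res a e he' hea (by rwa [he₁])
    (by rwa [he₁, ha₁])]
  exact V.res_congr he₁ ha₁ _ _

lemma isInductiveOperation_comp (h : IsDoubleInductiveGroupoid H V) :
    IsInductiveOperation V (fun a b => H.cod a = H.dom b) H.comp where
  dom a b hab := by rw [← h.dom_cod, hab, h.dom_dom]
  cod a b hab := by rw [← h.cod_cod, hab, h.cod_dom]
  comp a b c d hac hbd hab hcd := by
    have h₁ : V.cod (H.cod a) = V.dom (H.cod c) := by rw [h.cod_cod, hac, h.dom_cod]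
    have h₂ : V.cod (H.dom b) = V.dom (H.dom d) := by rw [h.cod_dom, hbd, h.dom_dom]
    rw [h.vert_horiz.cod_comp a c hac h₁, h.vert_horiz.dom_comp b d hbd h₂]
    exact V.comp_congr hab hcd _
  meet a b c d ha hb hc hd hab hcd := by
    rw [h.vert_horiz.cod_meet a c ha hc (h.cod_mem_vert ha) (h.cod_mem_vert hc),
      h.vert_horiz.dom_meet b d hb hd (h.dom_mem_vert hb) (h.dom_mem_vert hd)]
    exact V.meet_congr hab hcd _ _
  cores a b e k he hea hk hkb hab hek := by
    have h₁ := h.isInductiveFunctor_cod.map_le _ _ hea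
    have h₂ := h.isInductiveFunctor_dom.map_le _ _ hkb
    rw [← h.cod_cod] at h₁
    rw [← h.cod_dom] at h₂
    rw [h.vert_horiz.cod_cores a e he hea (h.cod_mem_vert he) h₁,
      h.vert_horiz.dom_cores b k hk hkb (h.dom_mem_vert hk) h₂]
    exact V.cores_congr hab hek _ _
  res a b e k he hea hk hkb hab hek := by
    have h₁ := h.isInductiveFunctor_cod.map_le _ _ hea
    have h₂ := h.isInductiveFunctor_dom.map_le _ _ hkb
    rw [← h.dom_cod] at h₁
    rw [← h.dom_dom] at h₂
    rw [h.vert_horiz.cod_res a e he hea (h.cod_mem_vert he) h₁,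
      h.vert_horiz.dom_res b k hk hkb (h.dom_mem_vert hk) h₂]
    exact V.res_congr hek hab _ _
  map_dom := h.horiz_vert.dom_comp
  map_cod := h.horiz_vert.cod_comp
  map_comp a b c d hac hbd hab hcd h₃ h₄ := (h.interchange a b c d hab hcd hac hbd h₄ h₃).symm
  map_meet a b c d ha hb hc hd hab hcd h₃ h₄ h₅ :=
    h.vert_horiz.meet_comp a c b d ha hc hb hd hab hcd h₃ h₄ h₅
  map_cores a b e k he hea hk hkb hab hek h₃ h₄ h₅ :=
    (h.vert_horiz.cores_comp a b e k hab hek h₄ h₅ he hea hk hkb h₃).symm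

lemma isInductiveOperation_meet (h : IsDoubleInductiveGroupoid H V) :
    IsInductiveOperation V (fun a b => a ∈ H.obj ∧ b ∈ H.obj)
      (fun a b hab => H.meet a b hab.1 hab.2) where
  dom _ _ hab := ⟨h.symm.dom_mem_vert hab.1, h.symm.dom_mem_vert hab.2⟩
  cod _ _ hab := ⟨h.symm.cod_mem_vert hab.1, h.symm.cod_mem_vert hab.2⟩
  comp _ _ _ _ hac hbd hab hcd :=
    ⟨h.comp_mem_horiz hac hab.1 hcd.1, h.comp_mem_horiz hbd hab.2 hcd.2⟩
  meet _ _ _ _ ha hb hc hd hab hcd :=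
    ⟨h.meet_mem_horiz ha hc hab.1 hcd.1, h.meet_mem_horiz hb hd hab.2 hcd.2⟩
  cores _ _ _ _ he hea hk hkb hab hek :=
    ⟨h.cores_mem_horiz he hea hab.1 hek.1, h.cores_mem_horiz hk hkb hab.2 hek.2⟩
  res _ _ _ _ he hea hk hkb hab hek :=
    ⟨h.res_mem_horiz he hea hab.1 hek.1, h.res_mem_horiz hk hkb hab.2 hek.2⟩
  map_dom a b hab hab' := h.horiz_vert.dom_meet a b hab.1 hab.2 hab'.1 hab'.2
  map_cod a b hab hab' := h.horiz_vert.cod_meet a b hab.1 hab.2 hab'.1 hab'.2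
  map_comp a b c d hac hbd hab hcd h₃ h₄ :=
    (h.horiz_vert.meet_comp a b c d hab.1 hab.2 hcd.1 hcd.2 hac hbd h₄ h₃.1 h₃.2).symm
  map_meet a b c d ha hb hc hd hab hcd h₃ h₄ h₅ :=
    (h.meet_meet a b c d hab.1 hab.2 hcd.1 hcd.2 ha hb hc hd h₄ h₅ h₃.1 h₃.2).symm
  map_cores a b e k he hea hk hkb hab hek h₃ h₄ h₅ :=
    h.vert_horiz.meet_cores a e b k hab.1 hab.2 he hek.1 hk hek.2 hea hkb h₃.1 h₃.2 h₄ h₅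

/-- Like the other vertical operations, vertical composition preserves the horizontal order between
vertical arrows because it preserves horizontal meets. -/
lemma comp_le_horiz (h : IsDoubleInductiveGroupoid H V) {a b c d : D} (hac : V.cod a = V.dom c)
    (hbd : V.cod b = V.dom d) (ha : a ∈ H.obj) (hb : b ∈ H.obj) (hc : c ∈ H.obj) (hd : d ∈ H.obj)
    (hab : H.le a b) (hcd : H.le c d) : H.le (V.comp a c hac) (V.comp b d hbd) := by
  have h₁ := h.horiz.meet_eq_of_le ha hb hab
  have h₂ := h.horiz.meet_eq_of_le hc hd hcd
  have h₃ := h.isInductiveOperation_meet.map_comp a b c d hac hbd ⟨ha, hb⟩ ⟨hc, hd⟩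
    ⟨h.comp_mem_horiz hac ha hc, h.comp_mem_horiz hbd hb hd⟩ (by rw [h₁, h₂, hac])
  exact h.horiz.le_of_meet_eq _ _ (h₃.trans (V.comp_congr h₁ h₂ _))

lemma meet_le_horiz (h : IsDoubleInductiveGroupoid H V) {a b c d : D} (ha' : a ∈ V.obj)
    (hb' : b ∈ V.obj) (hc' : c ∈ V.obj) (hd' : d ∈ V.obj) (ha : a ∈ H.obj) (hb : b ∈ H.obj)
    (hc : c ∈ H.obj) (hd : d ∈ H.obj) (hab : H.le a b) (hcd : H.le c d) :
    H.le (V.meet a c ha' hc') (V.meet b d hb' hd') := by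
  have h₁ := h.horiz.meet_eq_of_le ha hb hab
  have h₂ := h.horiz.meet_eq_of_le hc hd hcd
  have h₃ := h.isInductiveOperation_meet.map_meet a b c d ha' hb' hc' hd' ⟨ha, hb⟩ ⟨hc, hd⟩
    ⟨h.meet_mem_horiz ha' hc' ha hc, h.meet_mem_horiz hb' hd' hb hd⟩ (by rwa [h₁]) (by rwa [h₂])
  exact h.horiz.le_of_meet_eq _ _ (h₃.trans (V.meet_congr h₁ h₂ _ _))

lemma cores_le_horiz (h : IsDoubleInductiveGroupoid H V) {a b e k : D} (he' : e ∈ V.obj)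
    (hea : V.le e (V.cod a)) (hk' : k ∈ V.obj) (hkb : V.le k (V.cod b)) (ha : a ∈ H.obj)
    (hb : b ∈ H.obj) (he : e ∈ H.obj) (hk : k ∈ H.obj) (hab : H.le a b) (hek : H.le e k) :
    H.le (V.cores a e he' hea) (V.cores b k hk' hkb) := by
  have h₁ := h.horiz.meet_eq_of_le ha hb hab
  have h₂ := h.horiz.meet_eq_of_le he hk hek
  have h₃ := h.isInductiveOperation_meet.map_cores a b e k he' hea hk' hkb ⟨ha, hb⟩ ⟨he, hk⟩
    ⟨h.cores_mem_horiz he' hea ha he, h.cores_mem_horiz hk' hkb hb hk⟩ (by rwa [h₂])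
    (by rwa [h₁, h₂])
  exact h.horiz.le_of_meet_eq _ _ (h₃.trans (V.cores_congr h₁ h₂ _ _))

lemma res_le_horiz (h : IsDoubleInductiveGroupoid H V) {a b e k : D} (he' : e ∈ V.obj)
    (hea : V.le e (V.dom a)) (hk' : k ∈ V.obj) (hkb : V.le k (V.dom b)) (ha : a ∈ H.obj)
    (hb : b ∈ H.obj) (he : e ∈ H.obj) (hk : k ∈ H.obj) (hab : H.le a b) (hek : H.le e k) :
    H.le (V.res e a he' hea) (V.res k b hk' hkb) := by
  have h₁ := h.horiz.meet_eq_of_le ha hb hab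
  have h₂ := h.horiz.meet_eq_of_le he hk hek
  have h₃ := h.isInductiveOperation_meet.map_res h.vert he' hea hk' hkb ⟨ha, hb⟩ ⟨he, hk⟩
    ⟨h.res_mem_horiz he' hea ha he, h.res_mem_horiz hk' hkb hb hk⟩ (by rwa [h₂])
    (by rwa [h₁, h₂])
  exact h.horiz.le_of_meet_eq _ _ (h₃.trans (V.res_congr h₂ h₁ _ _))

lemma isInductiveOperation_cores (h : IsDoubleInductiveGroupoid H V) :
    IsInductiveOperation V (fun a e => e ∈ H.obj ∧ H.le e (H.cod a))
      (fun a e hae => H.cores a e hae.1 hae.2) where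
  dom a b hab := ⟨h.symm.dom_mem_vert hab.1, by
    rw [← h.dom_cod]
    exact h.symm.isInductiveFunctor_dom.map_le _ _ hab.2⟩
  cod a b hab := ⟨h.symm.cod_mem_vert hab.1, by
    rw [← h.cod_cod]
    exact h.symm.isInductiveFunctor_cod.map_le _ _ hab.2⟩
  comp a b c d hac hbd hab hcd := ⟨h.comp_mem_horiz hbd hab.1 hcd.1, by
    have hac' : V.cod (H.cod a) = V.dom (H.cod c) := by rw [h.cod_cod, hac, h.dom_cod]
    rw [h.vert_horiz.cod_comp a c hac hac']
    exact h.comp_le_horiz hbd hac' hab.1 (h.horiz.cod_mem a) hcd.1 (h.horiz.cod_mem c) hab.2 hcd.2⟩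
  meet a b c d ha hb hc hd hab hcd := ⟨h.meet_mem_horiz hb hd hab.1 hcd.1, by
    have ha' := h.cod_mem_vert ha
    have hc' := h.cod_mem_vert hc
    rw [h.vert_horiz.cod_meet a c ha hc ha' hc']
    exact h.meet_le_horiz hb ha' hd hc' hab.1 (h.horiz.cod_mem a) hcd.1 (h.horiz.cod_mem c)
      hab.2 hcd.2⟩
  cores a b e k he hea hk hkb hab hek := ⟨h.cores_mem_horiz hk hkb hab.1 hek.1, by
    have hea' := h.isInductiveFunctor_cod.map_le _ _ hea
    rw [← h.cod_cod] at hea'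
    rw [h.vert_horiz.cod_cores a e he hea (h.cod_mem_vert he) hea']
    exact h.cores_le_horiz hk hkb (h.cod_mem_vert he) hea' hab.1 (h.horiz.cod_mem a) hek.1
      (h.horiz.cod_mem e) hab.2 hek.2⟩
  res a b e k he hea hk hkb hab hek := ⟨h.res_mem_horiz hk hkb hab.1 hek.1, by
    have hea' := h.isInductiveFunctor_cod.map_le _ _ hea
    rw [← h.dom_cod] at hea'
    rw [h.vert_horiz.cod_res a e he hea (h.cod_mem_vert he) hea']
    exact h.res_le_horiz hk hkb (h.cod_mem_vert he) hea' hab.1 (h.horiz.cod_mem a) hek.1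
      (h.horiz.cod_mem e) hab.2 hek.2⟩
  map_dom a b hab hab' := h.horiz_vert.dom_cores a b hab.1 hab.2 hab'.1 hab'.2
  map_cod a b hab hab' := h.horiz_vert.cod_cores a b hab.1 hab.2 hab'.1 hab'.2
  map_comp a b c d hac hbd hab hcd h₃ h₄ :=
    h.horiz_vert.cores_comp a c b d hac hbd h₃.1 h₃.2 hab.1 hab.2 hcd.1 hcd.2 h₄
  map_meet a b c d ha hb hc hd hab hcd h₃ h₄ h₅ :=
    (h.horiz_vert.meet_cores a b c d ha hc hab.1 hb hcd.1 hd hab.2 hcd.2 h₄ h₅ h₃.1 h₃.2).symm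
  map_cores a b e k he hea hk hkb hab hek h₃ h₄ h₅ :=
    h.cores_cores a e b k he hea hab.1 hab.2 hek.1 hk hek.2 hkb h₃.1 h₃.2 h₄ h₅

lemma isInductiveOperation_res (h : IsDoubleInductiveGroupoid H V) :
    IsInductiveOperation V (fun e a => e ∈ H.obj ∧ H.le e (H.dom a))
      (fun e a hea => H.res e a hea.1 hea.2) where
  dom b a hab := ⟨h.symm.dom_mem_vert hab.1, by
    rw [← h.dom_dom]
    exact h.symm.isInductiveFunctor_dom.map_le _ _ hab.2⟩
  cod b a hab := ⟨h.symm.cod_mem_vert hab.1, by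
    rw [← h.cod_dom]
    exact h.symm.isInductiveFunctor_cod.map_le _ _ hab.2⟩
  comp b a d c hbd hac hab hcd := ⟨h.comp_mem_horiz hbd hab.1 hcd.1, by
    have hac' : V.cod (H.dom a) = V.dom (H.dom c) := by rw [h.cod_dom, hac, h.dom_dom]
    rw [h.vert_horiz.dom_comp a c hac hac']
    exact h.comp_le_horiz hbd hac' hab.1 (h.horiz.dom_mem a) hcd.1 (h.horiz.dom_mem c) hab.2 hcd.2⟩
  meet b a d c hb ha hd hc hab hcd := ⟨h.meet_mem_horiz hb hd hab.1 hcd.1, by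
    have ha' := h.dom_mem_vert ha
    have hc' := h.dom_mem_vert hc
    rw [h.vert_horiz.dom_meet a c ha hc ha' hc']
    exact h.meet_le_horiz hb ha' hd hc' hab.1 (h.horiz.dom_mem a) hcd.1 (h.horiz.dom_mem c)
      hab.2 hcd.2⟩
  cores b a k e hk hkb he hea hab hek := ⟨h.cores_mem_horiz hk hkb hab.1 hek.1, by
    have hea' := h.isInductiveFunctor_dom.map_le _ _ hea
    rw [← h.cod_dom] at hea'
    rw [h.vert_horiz.dom_cores a e he hea (h.dom_mem_vert he) hea']
    exact h.cores_le_horiz hk hkb (h.dom_mem_vert he) hea' hab.1 (h.horiz.dom_mem a) hek.1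
      (h.horiz.dom_mem e) hab.2 hek.2⟩
  res b a k e hk hkb he hea hab hek := ⟨h.res_mem_horiz hk hkb hab.1 hek.1, by
    have hea' := h.isInductiveFunctor_dom.map_le _ _ hea
    rw [← h.dom_dom] at hea'
    rw [h.vert_horiz.dom_res a e he hea (h.dom_mem_vert he) hea']
    exact h.res_le_horiz hk hkb (h.dom_mem_vert he) hea' hab.1 (h.horiz.dom_mem a) hek.1
      (h.horiz.dom_mem e) hab.2 hek.2⟩
  map_dom b a hab hab' := h.horiz_vert.dom_res a b hab.1 hab.2 hab'.1 hab'.2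
  map_cod b a hab hab' := h.horiz_vert.cod_res a b hab.1 hab.2 hab'.1 hab'.2
  map_comp b a d c hbd hac hab hcd h₃ h₄ :=
    h.horiz_vert.res_comp a c b d hac hbd h₃.1 h₃.2 hab.1 hab.2 hcd.1 hcd.2 h₄
  map_meet b a d c hb ha hd hc hab hcd h₃ h₄ h₅ :=
    (h.horiz_vert.meet_res a b c d ha hc hab.1 hb hcd.1 hd hab.2 hcd.2 h₄ h₅ h₃.1 h₃.2).symm
  map_cores b a k e hk hkb he hea hab hek h₃ h₄ h₅ :=
    h.res_cores a e b k he hea hab.1 hab.2 hek.1 hk hek.2 hkb h₃.1 h₃.2 h₄ h₅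

/-- The middle-four interchange law holds because every step in the formation of the horizontal
product (codomains and domains, the meet, the corestriction and the restriction, the composite)
is vertically inductive and hence preserves the vertical product. -/
lemma isDoubleInverseSemigroup (h : IsDoubleInductiveGroupoid H V) :
    IsDoubleInverseSemigroup (H.prod h.horiz) (V.prod h.vert) where
  horiz := h.horiz.isInverseSemigroup_prod
  vert := h.vert.isInverseSemigroup_prod
  interchange a b c d := by
    have hcod := h.isInductiveFunctor_cod.map_prod h.vert h.vert a b
    have hdom := h.isInductiveFunctor_dom.map_prod h.vert h.vert c d
    have hP₁ : H.cod a ∈ H.obj ∧ H.dom c ∈ H.obj := ⟨h.horiz.cod_mem a, h.horiz.dom_mem c⟩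
    have hP₂ : H.cod b ∈ H.obj ∧ H.dom d ∈ H.obj := ⟨h.horiz.cod_mem b, h.horiz.dom_mem d⟩
    have hm := h.isInductiveOperation_meet.map_prod h.vert hP₁ hP₂
      (h.isInductiveOperation_meet.prod h.vert hP₁ hP₂)
    have hx₁ := And.intro (h.horiz.meet_mem _ _ hP₁.1 hP₁.2) (h.horiz.meet_le_left _ _ hP₁.1 hP₁.2)
    have hx₂ := And.intro (h.horiz.meet_mem _ _ hP₂.1 hP₂.2) (h.horiz.meet_le_left _ _ hP₂.1 hP₂.2)
    have hy₁ := And.intro (h.horiz.meet_mem _ _ hP₁.1 hP₁.2) (h.horiz.meet_le_right _ _ hP₁.1 hP₁.2)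
    have hy₂ := And.intro (h.horiz.meet_mem _ _ hP₂.1 hP₂.2) (h.horiz.meet_le_right _ _ hP₂.1 hP₂.2)
    have hx := h.isInductiveOperation_cores.prod h.vert hx₁ hx₂
    have hy := h.isInductiveOperation_res.prod h.vert hy₁ hy₂
    rw [h.horiz.prod_eq (hm.symm.trans (H.meet_congr hcod.symm hdom.symm _ _)) hx.1 hx.2 hy.2,
      H.comp_congr (h.isInductiveOperation_cores.map_prod h.vert hx₁ hx₂ hx)
        (h.isInductiveOperation_res.map_prod h.vert hy₁ hy₂ hy)]
    exact h.isInductiveOperation_comp.map_prod h.vert _ _ _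

end IsDoubleInductiveGroupoid

/-! ### The isomorphism of categories -/

lemma DIG.ext_of_data {G G' : DIG.{u}} (hD : G.Dbl = G'.Dbl) (hH : G.H ≍ G'.H) (hV : G.V ≍ G'.V) :
    G = G' := by
  cases G
  cases G'
  dsimp only at *
  subst hD
  subst hH hV
  rfl

lemma DIS.ext_of_ops {S S' : DIS.{u}} (hS : S.carrier = S'.carrier) (hh : S.hop ≍ S'.hop)
    (hv : S.vop ≍ S'.vop) : S = S' := by
  cases S
  cases S'
  dsimp only at *
  subst hS
  subst hh hv
  rfl

lemma DoubleInductiveFunctor.heq_of_cell {G₁ G₂ G₁' G₂' : DIG.{u}} (h₁ : G₁ = G₁') (h₂ : G₂ = G₂')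
    {f : DoubleInductiveFunctor G₁ G₂} {f' : DoubleInductiveFunctor G₁' G₂'}
    (h : f.cell ≍ f'.cell) : f ≍ f' := by
  subst h₁ h₂
  exact heq_of_eq (DoubleInductiveFunctor.ext (eq_of_heq h))

lemma DoubleSemigroupHom.heq_of_toFun {S₁ S₂ S₁' S₂' : DIS.{u}} (h₁ : S₁ = S₁') (h₂ : S₂ = S₂')
    {f : DoubleSemigroupHom S₁ S₂} {f' : DoubleSemigroupHom S₁' S₂'}
    (h : f.toFun ≍ f'.toFun) : f ≍ f' := by
  subst h₁ h₂
  exact heq_of_eq (DoubleSemigroupHom.ext (eq_of_heq h))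

theorem mainTheorem2 :
    ∃ (hDIS : ∀ G : DIG.{u}, IsDoubleInverseSemigroup G.hprod G.vprod)
      (hF : ∀ (G G' : DIG.{u}) (f : DoubleInductiveFunctor G G') (a b : G.Dbl),
        f.cell (G.hprod a b) = G'.hprod (f.cell a) (f.cell b) ∧
          f.cell (G.vprod a b) = G'.vprod (f.cell a) (f.cell b))
      (hDIG : ∀ S : DIS.{u}, IsDoubleInductiveGroupoid S.horizData S.vertData)
      (hF' : ∀ (S S' : DIS.{u}) (φ : DoubleSemigroupHom S S'),
        IsInductiveFunctor S.horizData S'.horizData φ.toFun ∧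
          IsInductiveFunctor S.vertData S'.vertData φ.toFun),
      functorDIS hDIS hF ⋙ functorDIG hDIG hF' = 𝟭 DIG.{u} ∧
        functorDIG hDIG hF' ⋙ functorDIS hDIS hF = 𝟭 DIS.{u} := by
  have hDIS (G : DIG.{u}) : IsDoubleInverseSemigroup G.hprod G.vprod :=
    G.laws.isDoubleInverseSemigroup
  have hF (G G' : DIG.{u}) (f : DoubleInductiveFunctor G G') (a b : G.Dbl) :
      f.cell (G.hprod a b) = G'.hprod (f.cell a) (f.cell b) ∧
        f.cell (G.vprod a b) = G'.vprod (f.cell a) (f.cell b) :=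
    ⟨f.horiz.map_prod G.laws.horiz G'.laws.horiz a b,
      f.vert.map_prod G.laws.vert G'.laws.vert a b⟩
  have hDIG (S : DIS.{u}) : IsDoubleInductiveGroupoid S.horizData S.vertData :=
    S.laws.isDoubleInductiveGroupoid
  have hF' (S S' : DIS.{u}) (φ : DoubleSemigroupHom S S') :
      IsInductiveFunctor S.horizData S'.horizData φ.toFun ∧
        IsInductiveFunctor S.vertData S'.vertData φ.toFun :=
    ⟨S.laws.horiz.isInductiveFunctor_of_hom S'.laws.horiz φ.map_hop,
      S.laws.vert.isInductiveFunctor_of_hom S'.laws.vert φ.map_vop⟩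
  refine ⟨hDIS, hF, hDIG, hF', ?_, ?_⟩
  · have hobj (G : DIG.{u}) : (functorDIS hDIS hF ⋙ functorDIG hDIG hF').obj G = G :=
      DIG.ext_of_data rfl (heq_of_eq (G.laws.horiz.groupoidData_prod (hDIS G).horiz))
        (heq_of_eq (G.laws.vert.groupoidData_prod (hDIS G).vert))
    exact Functor.hext hobj fun G G' f =>
      DoubleInductiveFunctor.heq_of_cell (hobj G) (hobj G') HEq.rfl
  · have hobj (S : DIS.{u}) : (functorDIG hDIG hF' ⋙ functorDIS hDIS hF).obj S = S :=
      DIS.ext_of_ops rfl (heq_of_eq (S.laws.horiz.prod_groupoidData (hDIG S).horiz))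
        (heq_of_eq (S.laws.vert.prod_groupoidData (hDIG S).vert))
    exact Functor.hext hobj fun S S' φ =>
      DoubleSemigroupHom.heq_of_toFun (hobj S) (hobj S') HEq.rfl
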